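/- Let $d\ge 1$, let $V:\mathbb Z^d\to\mathbb R$ be bounded, and let $H=H_0+V$ be the Schrödinger operator on $\ell^2(\mathbb Z^d)$, where $(H_0u)(n)=\sum_{i=1}^d\big(u(n+e_i)+u(n-e_i)\big)$. Write $|n|=\max_i|n_i|$, $\langle n\rangle=(1+|n|^2)^{1/2}$ and $\Lambda_L(n_0)=\{n\in\mathbb Z^d: |n-n_0|\le L\}$. A polynomially bounded generalized eigenfunction of $H$ with energy $E$ is a function $\psi:\mathbb Z^d\to\mathbb C$ with $H\psi(n)=E\psi(n)$ for all $n$ and $|\psi(n)|\le C\langle n\rangle^k$ for all $n$, for some $C>0$, $k\in\mathbb N$. Let $\varphi:\mathbb Z^d\to(0,\infty)$ satisfy $\varphi(n)\le C e^{|n|^\beta}$ for all $n$, for some constants $C$ and $\beta<1$, let $\varphi(X)$ be multiplication by $\varphi$ (on its maximal domain), and for $k\in\mathbb Z^d$, $T>0$ put $$\mathcal M_{\varphi;k}(T)=\frac1T\int_0^\infty e^{-t/T}\,\langle\delta_k,e^{iHt}\varphi(X)e^{-iHt}\delta_k\rangle\,dt .$$ **Theorem.** Let $I\subset\mathbb R$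 be a set of positive Lebesgue measure. Suppose that there are $\nu\in[0,1)$ and $n_0\in\mathbb Z^d$ such that for Lebesgue almost every $E\in I$ there are a polynomially bounded generalized eigenfunction $\psi_E$ of $H$ with energy $E$ and $\psi_E(n_0)\ne0$, and a finite constant $A_E>0$, with $$\sum_{n\in\Lambda_L(n_0)}\frac{|\psi_E(n)|^2}{\varphi(n)}\le A_E\,L^\nu\qquad\text{for all integers }L\ge1 .$$ Then $e^{-iHt}\delta_{n_0}$ lies in the domain of $\varphi(X)$ for every $t\in\mathbb R$, the integral defining $\mathcal M_{\varphi;n_0}(T)$ converges absolutely for every $T>0$, and for every $\alpha>1$ there is a constant $C>0$, not depending on $T$, such that $$\mathcal M_{\varphi;n_0}(T)\ \ge\ C\,T^{1-\alpha\nu}$$ for all $T\ge1$, and even for all $T>0$ if $\alpha\nu\le1$. -/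

import Mathlib

open MeasureTheory

noncomputable section

namespace LatticeTransport

/-- The Hilbert space of square summable functions on the lattice `ℤ^d`. The norm on `Fin d → ℤ`
itself is Mathlib's, i.e. the maximum norm. -/
abbrev Ell2 (d : ℕ) : Type := lp (fun _ : Fin d → ℤ => ℂ) 2

/-- The cube with centre `n₀` and radius `L` (side length `2L+1`). -/
def cube {d : ℕ} (n₀ : Fin d → ℤ) (L : ℕ) : Finset (Fin d → ℤ) :=
  Finset.Icc (fun i => n₀ i - (L : ℤ)) (fun i => n₀ i + (L : ℤ))

theorem mem_cube {d : ℕ} (n₀ n : Fin d → ℤ) (L : ℕ) : n ∈ cube n₀ L ↔ ‖n - n₀‖ ≤ (L : ℝ) := by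
  rw [cube, Finset.mem_Icc, pi_norm_le_iff_of_nonneg (Nat.cast_nonneg L), Pi.le_def, Pi.le_def,
    ← forall_and]
  refine forall_congr' fun i => ?_
  rw [Pi.sub_apply, Int.norm_eq_abs]
  have h : (|((n i - n₀ i : ℤ) : ℝ)| ≤ (L : ℝ)) ↔ |n i - n₀ i| ≤ (L : ℤ) := by
    exact_mod_cast Iff.rfl
  rw [h, abs_le]
  constructor <;> intro h <;> constructor <;> omega

/-- The difference expression `(H u)(n) = ∑ u(m) + V(n) u(n)`, the sum being over the `2d` nearest
neighbours `m = n ± eᵢ` of `n`, on arbitrary functions on the lattice. -/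
def diffExpr {d : ℕ} (V : (Fin d → ℤ) → ℝ) (u : (Fin d → ℤ) → ℂ) (n : Fin d → ℤ) : ℂ :=
  (∑ i : Fin d, (u (n + Pi.single i 1) + u (n - Pi.single i 1))) + (V n : ℂ) * u n

theorem memLp_shift {d : ℕ} (a : Fin d → ℤ) (u : Ell2 d) :
    Memℓp (fun n => u (n + a)) 2 := by
  refine memℓp_gen ?_
  exact ((lp.memℓp u).summable (by norm_num)).comp_injective (add_left_injective a)

/-- The translation `(τₐ u)(n) = u(n + a)` on `ℓ²(ℤ^d)`. -/
def shift {d : ℕ} (a : Fin d → ℤ) : Ell2 d →L[ℂ] Ell2 d :=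
  LinearMap.mkContinuous
    { toFun := fun u => ⟨fun n => u (n + a), memLp_shift a u⟩
      map_add' := fun u v => by ext n; rfl
      map_smul' := fun c u => by ext n; rfl } 1 (fun u => by
    refine lp.norm_le_of_tsum_le (p := 2) (by norm_num) (by positivity) ?_
    rw [one_mul, lp.norm_rpow_eq_tsum (by norm_num) u]
    exact le_of_eq ((Equiv.addRight a).tsum_eq
      (fun n => ‖u n‖ ^ (2 : ENNReal).toReal)))

theorem memLp_mul_bounded {d : ℕ} (V : (Fin d → ℤ) → ℝ) (hV : ∃ B : ℝ, ∀ n, |V n| ≤ B)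
    (u : Ell2 d) : Memℓp (fun n => (V n : ℂ) * u n) 2 := by
  obtain ⟨B, hB⟩ := hV
  refine Memℓp.mono (g := fun n => ‖(B : ℂ) * u n‖)
    (memℓp_norm_iff.mpr ((lp.memℓp u).const_mul (B : ℂ))) (fun n => ?_)
  rw [norm_mul, norm_mul, Complex.norm_real, Complex.norm_real, Real.norm_eq_abs, Real.norm_eq_abs]
  exact mul_le_mul_of_nonneg_right ((hB n).trans (le_abs_self B)) (norm_nonneg _)

/-- Multiplication by a bounded real potential on `ℓ²(ℤ^d)`. -/
def potential {d : ℕ} (V : (Fin d → ℤ) → ℝ) (hV : ∃ B : ℝ, ∀ n, |V n| ≤ B) :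
    Ell2 d →L[ℂ] Ell2 d :=
  LinearMap.mkContinuous
    { toFun := fun u => ⟨fun n => (V n : ℂ) * u n, memLp_mul_bounded V hV u⟩
      map_add' := fun u v => by ext n; exact mul_add _ _ _
      map_smul' := fun c u => by ext n; exact mul_left_comm _ _ _ } hV.choose (fun u => by
    have hB := hV.choose_spec
    have h0 : 0 ≤ hV.choose := (abs_nonneg _).trans (hB 0)
    refine (lp.norm_mono (p := 2) (by norm_num) (y := (hV.choose : ℂ) • u) (fun n => ?_)).trans ?_
    · change ‖(V n : ℂ) * u n‖ ≤ ‖(hV.choose : ℂ) * u n‖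
      rw [norm_mul, norm_mul, Complex.norm_real, Complex.norm_real, Real.norm_eq_abs,
        Real.norm_eq_abs]
      exact mul_le_mul_of_nonneg_right ((hB n).trans (le_abs_self _)) (norm_nonneg _)
    · rw [norm_smul, Complex.norm_real, Real.norm_of_nonneg h0])

/-- The Schrödinger operator `H = H₀ + V` with bounded potential on `ℓ²(ℤ^d)`. -/
def hamiltonian {d : ℕ} (V : (Fin d → ℤ) → ℝ) (hV : ∃ B : ℝ, ∀ n, |V n| ≤ B) :
    Ell2 d →L[ℂ] Ell2 d :=
  (∑ i : Fin d, (shift (Pi.single i 1) + shift (-Pi.single i 1))) + potential V hV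

/-- The operator acts by the difference expression. -/
theorem hamiltonian_apply {d : ℕ} (V : (Fin d → ℤ) → ℝ) (hV : ∃ B : ℝ, ∀ n, |V n| ≤ B)
    (u : Ell2 d) (n : Fin d → ℤ) : hamiltonian V hV u n = diffExpr V u n := by
  change lp.evalₗ (𝕜 := ℂ) (E := fun _ : Fin d → ℤ => ℂ) (p := 2) n (hamiltonian V hV u) = _
  simp only [hamiltonian, diffExpr, sub_eq_add_neg, add_apply, sum_apply, map_add, map_sum]
  rfl

/-- The unitary group `e^{-itH}`. -/
def evolution {d : ℕ} (V : (Fin d → ℤ) → ℝ) (hV : ∃ B : ℝ, ∀ n, |V n| ≤ B) (t : ℝ) :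
    Ell2 d →L[ℂ] Ell2 d :=
  NormedSpace.exp ((-Complex.I * (t : ℂ)) • hamiltonian V hV)

/-- `u` lies in the domain of the (in general unbounded) multiplication operator `φ(X)`. -/
def InDomain {d : ℕ} (φ : (Fin d → ℤ) → ℝ) (u : Ell2 d) : Prop :=
  Memℓp (fun n => (φ n : ℂ) * u n) 2

open Classical in
/-- The multiplication operator `φ(X)`, with value `φ · u` on its domain (and `0` off it). -/
def mulOp {d : ℕ} (φ : (Fin d → ℤ) → ℝ) (u : Ell2 d) : Ell2 d :=
  if h : InDomain φ u then ⟨fun n => (φ n : ℂ) * u n, h⟩ else 0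

/-- The unit vector `δ_k`. -/
def delta {d : ℕ} (k : Fin d → ℤ) : Ell2 d := lp.single 2 k (1 : ℂ)

/-- `⟨δ_k, e^{itH} φ(X) e^{-itH} δ_k⟩`, a real number for real `φ`. -/
def expectation {d : ℕ} (V : (Fin d → ℤ) → ℝ) (hV : ∃ B : ℝ, ∀ n, |V n| ≤ B)
    (φ : (Fin d → ℤ) → ℝ) (k : Fin d → ℤ) (t : ℝ) : ℝ :=
  (inner ℂ (delta k) (evolution V hV (-t) (mulOp φ (evolution V hV t (delta k))))).re

/-- The exponentially time-averaged moment
`(1/T) ∫₀^∞ e^{-t/T} ⟨δ_k, e^{itH} φ(X) e^{-itH} δ_k⟩ dt`. -/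
def moment {d : ℕ} (V : (Fin d → ℤ) → ℝ) (hV : ∃ B : ℝ, ∀ n, |V n| ≤ B)
    (φ : (Fin d → ℤ) → ℝ) (k : Fin d → ℤ) (T : ℝ) : ℝ :=
  (1 / T) * ∫ t in Set.Ioi (0 : ℝ), Real.exp (-(t / T)) * expectation V hV φ k t

/-- The Japanese bracket `⟨n⟩ = (1 + |n|²)^{1/2}`. -/
def bracket {d : ℕ} (n : Fin d → ℤ) : ℝ := Real.sqrt (1 + ‖n‖ ^ 2)

/-- `ψ` is a polynomially bounded generalized eigenfunction of `H₀ + V` with energy `E`. -/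
def IsPBGenEigenfunction {d : ℕ} (V : (Fin d → ℤ) → ℝ) (E : ℂ) (ψ : (Fin d → ℤ) → ℂ) : Prop :=
  (∀ n, diffExpr V ψ n = E * ψ n) ∧
    ∃ k : ℕ, ∃ C : ℝ, 0 < C ∧ ∀ n, ‖ψ n‖ ≤ C * bracket n ^ k

/-- `φ` is bounded by a constant times `e^{|n|^β}`, for some `β < 1`. -/
def HasSubexpGrowth {d : ℕ} (φ : (Fin d → ℤ) → ℝ) : Prop :=
  ∃ C β : ℝ, β < 1 ∧ ∀ n, φ n ≤ C * Real.exp (‖n‖ ^ β)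

end LatticeTransport

end

noncomputable section

namespace LatticeTransport

/-! Write u(t) = e^{-itH} δ_k with k = n₀, and G(E, n) = ∫₀^∞ e^{(iE-ε)t} u(t)(n) dt with ε =
1/(2T). Pairing with a generalized eigenfunction turns the evolution into a phase, ∑ ψ_E(n) u(t)(n)
= e^{-iEt} ψ_E(k) (`hasSum_eigenfunction_mul_wave`), so averaging against ε e^{-εt} formally gives ε
∑ ψ_E(n) G(E, n) = ψ_E(k). The wave spreads at bounded speed up to exponential tails
(`expMass_wave_le`), hence the sum may be cut to the cube of radius ⌈T^α⌉, α > 1, with an error that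
vanishes as T → ∞ (`norm_sub_sum_green_le`, `tendsto_truncation_error`). So ∑ |ψ_E| |G| ≥ T |ψ_E(k)|
on that cube for large T, and Cauchy–Schwarz with the weights 1/φ and φ yields ∑ φ |G|² ≥ c_E
T^{2-αν} (`exists_le_sum_green`).

Plancherel in E bounds ∫ ∑ φ |G|² dE by 2πT times the moment (`le_moment`), which leaves the power
T^{1-αν}. The dependence of the constants on E is removed by a countable decomposition of I
(`exists_le_moment_of_large`). Bounded T only needs the continuity of u at t = 0
(`exists_le_moment_of_le`). -/

/-! ### Plancherel on L¹ ∩ L². -/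

open scoped FourierTransform SchwartzMap ContDiff in
/-- The Fourier transform on `L²` agrees with the Fourier integral on `L¹ ∩ L²`. -/
theorem fourier_toLp_ae_eq {f : ℝ → ℂ} (h1 : Integrable f) (h2 : MemLp f 2) :
    (𝓕 (h2.toLp f) : Lp ℂ 2 (volume : Measure ℝ)) =ᵐ[volume] 𝓕 f := by
  have hcont : Continuous (𝓕 f) := by
    exact VectorFourier.fourierIntegral_continuous (L := innerₗ ℝ) Real.continuous_fourierChar
      continuous_inner h1
  -- Both sides are tested against smooth compactly supported g. The distributional definition on
  -- one side and Fubini on the other move the transform onto g.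
  refine ae_eq_of_integral_contDiff_smul_eq
    ((Lp.memLp _).locallyIntegrable (by norm_num)) hcont.locallyIntegrable fun g hg hgs => ?_
  have hg₁ : HasCompactSupport (Complex.ofRealCLM ∘ g) := hgs.comp_left rfl
  have hg₂ : ContDiff ℝ ∞ (Complex.ofRealCLM ∘ g) := by fun_prop
  set G : 𝓢(ℝ, ℂ) := hg₁.toSchwartzMap hg₂ with hG
  have hGx : ∀ x, G x = (g x : ℂ) := fun x => rfl
  have e1 := congrArg (fun D => D G) (Lp.fourier_toTemperedDistribution_eq (h2.toLp f))
  simp only [TemperedDistribution.fourier_apply, Lp.toTemperedDistribution_apply] at e1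
  have e2 : ∫ x, (𝓕 G) x • (h2.toLp f) x = ∫ x, (𝓕 G) x • f x := by
    refine integral_congr_ae ?_
    filter_upwards [h2.coeFn_toLp] with x hx
    rw [hx]
  have e3 : ∫ x, (𝓕 G) x • f x = ∫ x, G x • 𝓕 f x := by
    simpa using! VectorFourier.integral_bilin_fourierIntegral_eq_flip
      (ContinuousLinearMap.lsmul ℂ ℂ : ℂ →L[ℂ] ℂ →L[ℂ] ℂ) (L := innerₗ ℝ)
      Real.continuous_fourierChar continuous_inner G.integrable h1
  have e4 := e1.symm.trans (e2.trans e3)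
  simpa [hGx] using e4

open scoped FourierTransform in
/-- Plancherel's theorem for functions in `L¹ ∩ L²`. -/
theorem lintegral_enorm_fourier_sq {f : ℝ → ℂ} (h1 : Integrable f) (h2 : MemLp f 2) :
    ∫⁻ ξ, ‖𝓕 f ξ‖ₑ ^ 2 = ∫⁻ x, ‖f x‖ₑ ^ 2 := by
  have key : eLpNorm (𝓕 f) 2 volume = eLpNorm f 2 volume := by
    rw [← eLpNorm_congr_ae (fourier_toLp_ae_eq h1 h2), ← eLpNorm_congr_ae h2.coeFn_toLp,
      ← Lp.enorm_def, ← Lp.enorm_def, ← ofReal_norm, ← ofReal_norm, Lp.norm_fourier_eq]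
  have h : ∀ g : ℝ → ℂ, ∫⁻ x, ‖g x‖ₑ ^ 2 = eLpNorm g 2 volume ^ 2 := fun g => by
    have := eLpNorm_nnreal_pow_eq_lintegral (f := g) (p := 2) (μ := (volume : Measure ℝ))
      (by norm_num)
    simpa using this.symm
  rw [h, h, key]

/-! ### Exponential propagation bounds and the eigenfunction pairing. -/

section

variable {d : ℕ}

/-- The exponentially weighted `ℓ¹` mass `∑ e^{|n-k|} |f(n)|`. -/
def expMass (k : Fin d → ℤ) (f : (Fin d → ℤ) → ℂ) : ENNReal :=
  ∑' n, ENNReal.ofReal (Real.exp ‖n - k‖) * ‖f n‖ₑ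

theorem ofReal_exp_norm_le (k n a : Fin d → ℤ) (ha : ‖a‖ ≤ 1) :
    ENNReal.ofReal (Real.exp ‖n - k‖) ≤
      ENNReal.ofReal (Real.exp 1) * ENNReal.ofReal (Real.exp ‖n + a - k‖) := by
  rw [← ENNReal.ofReal_mul (Real.exp_pos _).le, ← Real.exp_add]
  refine ENNReal.ofReal_le_ofReal (Real.exp_le_exp.mpr ?_)
  have h : n - k = (n + a - k) - a := by abel
  calc ‖n - k‖ = ‖(n + a - k) - a‖ := by rw [← h]
    _ ≤ ‖n + a - k‖ + ‖a‖ := norm_sub_le _ _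
    _ ≤ 1 + ‖n + a - k‖ := by linarith

theorem expMass_shift_le (k a : Fin d → ℤ) (ha : ‖a‖ ≤ 1) (f : (Fin d → ℤ) → ℂ) :
    expMass k (fun n => f (n + a)) ≤ ENNReal.ofReal (Real.exp 1) * expMass k f := by
  unfold expMass
  rw [← ENNReal.tsum_mul_left, ← (Equiv.addRight a).tsum_eq (fun n =>
    ENNReal.ofReal (Real.exp 1) * (ENNReal.ofReal (Real.exp ‖n - k‖) * ‖f n‖ₑ))]
  refine ENNReal.tsum_le_tsum fun n => ?_
  rw [← mul_assoc]
  exact mul_le_mul_left (ofReal_exp_norm_le k n a ha) _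

theorem norm_single_le_one (i : Fin d) : ‖(Pi.single i 1 : Fin d → ℤ)‖ ≤ 1 := by
  rw [Pi.norm_single]; simp

/-- The growth rate of `expMass` under the Hamiltonian with a potential bounded by `B`. -/
def growthRate (d : ℕ) (B : ℝ) : ℝ := d * (Real.exp 1 + Real.exp 1) + B

theorem growthRate_nonneg {B : ℝ} (hB : 0 ≤ B) : 0 ≤ growthRate d B := by
  unfold growthRate; positivity

theorem enorm_diffExpr_le {V : (Fin d → ℤ) → ℝ} {B : ℝ} (hV : ∀ n, |V n| ≤ B)
    (f : (Fin d → ℤ) → ℂ) (n : Fin d → ℤ) :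
    ‖diffExpr V f n‖ₑ ≤ (∑ i : Fin d, (‖f (n + Pi.single i 1)‖ₑ + ‖f (n + -Pi.single i 1)‖ₑ))
      + ENNReal.ofReal B * ‖f n‖ₑ := by
  refine (enorm_add_le _ _).trans (add_le_add ((enorm_sum_le _ _).trans
    (Finset.sum_le_sum fun i _ => ?_)) ?_)
  · rw [sub_eq_add_neg]; exact enorm_add_le _ _
  · rw [enorm_mul]
    refine mul_le_mul_left ?_ _
    rw [← ofReal_norm, Complex.norm_real]
    exact ENNReal.ofReal_le_ofReal (hV n)

/-- Each of the 2d unit shifts costs a factor e in the weight, and the potential costs B. -/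
theorem expMass_diffExpr_le {V : (Fin d → ℤ) → ℝ} {B : ℝ} (hB : 0 ≤ B) (hV : ∀ n, |V n| ≤ B)
    (k : Fin d → ℤ) (f : (Fin d → ℤ) → ℂ) :
    expMass k (diffExpr V f) ≤ ENNReal.ofReal (growthRate d B) * expMass k f := by
  have h1 : expMass k (diffExpr V f) ≤
      (∑ i : Fin d, (expMass k (fun n => f (n + Pi.single i 1)) +
        expMass k (fun n => f (n + -Pi.single i 1)))) + ENNReal.ofReal B * expMass k f := by
    have h2 : ∀ i : Fin d, expMass k (fun n => f (n + Pi.single i 1)) +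
        expMass k (fun n => f (n + -Pi.single i 1)) =
        ∑' n, ENNReal.ofReal (Real.exp ‖n - k‖) *
          (‖f (n + Pi.single i 1)‖ₑ + ‖f (n + -Pi.single i 1)‖ₑ) := fun i => by
      simp only [expMass, mul_add, ENNReal.tsum_add]
    rw [Finset.sum_congr rfl fun i _ => h2 i, ← Summable.tsum_finsetSum
      (fun i _ => ENNReal.summable), expMass, expMass, ← ENNReal.tsum_mul_left, ← ENNReal.tsum_add]
    refine ENNReal.tsum_le_tsum fun n => ?_
    refine (mul_le_mul_right (enorm_diffExpr_le hV f n) _).trans (le_of_eq ?_)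
    rw [mul_add, Finset.mul_sum]
    ring
  refine h1.trans ?_
  have h3 : ∀ i : Fin d, expMass k (fun n => f (n + Pi.single i 1)) +
        expMass k (fun n => f (n + -Pi.single i 1)) ≤
        (ENNReal.ofReal (Real.exp 1) + ENNReal.ofReal (Real.exp 1)) * expMass k f := fun i => by
    rw [add_mul]
    exact add_le_add (expMass_shift_le k _ (norm_single_le_one i) f)
      (expMass_shift_le k _ (by rw [norm_neg]; exact norm_single_le_one i) f)
  refine (add_le_add_left (Finset.sum_le_sum fun i _ => h3 i) _).trans (le_of_eq ?_)
  rw [Finset.sum_const, Finset.card_univ, Fintype.card_fin, nsmul_eq_mul, growthRate,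
    ENNReal.ofReal_add (by positivity) hB, ENNReal.ofReal_mul (by positivity),
    ENNReal.ofReal_add (by positivity) (by positivity), ENNReal.ofReal_natCast]
  ring

theorem delta_apply (k n : Fin d → ℤ) : (delta k : Ell2 d) n = if n = k then 1 else 0 := by
  unfold delta
  split_ifs with h
  · subst h; exact lp.single_apply_self (E := fun _ : Fin d → ℤ => ℂ) 2 n (1 : ℂ)
  · exact lp.single_apply_ne (E := fun _ : Fin d → ℤ => ℂ) 2 k (1 : ℂ) h

theorem expMass_delta (k : Fin d → ℤ) : expMass k (delta k : Ell2 d) = 1 := by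
  rw [expMass, tsum_eq_single k]
  · simp [delta_apply]
  · intro n hn; simp [delta_apply, hn]

variable (V : (Fin d → ℤ) → ℝ) (hV : ∃ B : ℝ, ∀ n, |V n| ≤ B)

theorem hamiltonian_pow_succ_apply (m : ℕ) (u : Ell2 d) :
    ⇑((hamiltonian V hV ^ (m + 1)) u) = diffExpr V ((hamiltonian V hV ^ m) u) := by
  ext n
  rw [pow_succ', mul_apply_eq_comp, hamiltonian_apply]

variable {V} in
theorem expMass_hamiltonian_pow_le {B : ℝ} (hB : 0 ≤ B) (hVB : ∀ n, |V n| ≤ B)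
    (k : Fin d → ℤ) (m : ℕ) :
    expMass k ((hamiltonian V hV ^ m) (delta k)) ≤ ENNReal.ofReal (growthRate d B) ^ m := by
  induction m with
  | zero => simp [expMass_delta]
  | succ m ih =>
    rw [hamiltonian_pow_succ_apply, pow_succ']
    exact (expMass_diffExpr_le hB hVB k _).trans (mul_le_mul_right ih _)

/-- The evolved vector `e^{-itH} δ_k`. -/
def wave (k : Fin d → ℤ) (t : ℝ) : Ell2 d := evolution V hV t (delta k)

theorem hasSum_wave (k : Fin d → ℤ) (t : ℝ) (n : Fin d → ℤ) :
    HasSum (fun m : ℕ => ((m.factorial : ℂ)⁻¹ * (-Complex.I * t) ^ m) *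
      ((hamiltonian V hV ^ m) (delta k)) n) (wave V hV k t n) := by
  have h := NormedSpace.exp_series_hasSum_exp' (𝕂 := ℂ) ((-Complex.I * (t : ℂ)) • hamiltonian V hV)
  have h2 := h.mapL (((lp.evalCLM ℂ (fun _ : Fin d → ℤ => ℂ) 2 n).comp
    (ContinuousLinearMap.apply ℂ (Ell2 d) (delta k))))
  convert! h2 using 2 with m
  rw [smul_pow]
  simp only [ContinuousLinearMap.comp_apply, ContinuousLinearMap.apply_apply,
    map_smul, smul_eq_mul, mul_assoc]
  rfl

theorem enorm_coeff (t : ℝ) (m : ℕ) : ‖(m.factorial : ℂ)⁻¹ * (-Complex.I * t) ^ m‖ₑ =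
    ENNReal.ofReal (|t| ^ m / m.factorial) := by
  rw [← ofReal_norm]
  congr 1
  simp [div_eq_inv_mul]

theorem tsum_ofReal_exp_series (t K : ℝ) (hK : 0 ≤ K) :
    ∑' m : ℕ, ENNReal.ofReal (|t| ^ m / m.factorial) * ENNReal.ofReal K ^ m =
      ENNReal.ofReal (Real.exp (K * |t|)) := by
  have h := NormedSpace.expSeries_div_hasSum_exp (K * |t|)
  rw [← Real.exp_eq_exp_ℝ] at h
  rw [← h.tsum_eq, ENNReal.ofReal_tsum_of_nonneg (fun m => by positivity) h.summable]
  congr 1; ext m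
  rw [← ENNReal.ofReal_pow hK, ← ENNReal.ofReal_mul (by positivity)]
  congr 1
  rw [mul_pow]; ring

-- Absolute convergence of the full double series, rather than of its sums over m, is what later
-- permits exchanging the power series with the lattice sum.
variable {V} in
theorem tsum_tsum_enorm_le {B : ℝ} (hB : 0 ≤ B) (hVB : ∀ n, |V n| ≤ B)
    (k : Fin d → ℤ) (t : ℝ) :
    ∑' n, ∑' m : ℕ, ENNReal.ofReal (Real.exp ‖n - k‖) *
      ‖((m.factorial : ℂ)⁻¹ * (-Complex.I * t) ^ m) * ((hamiltonian V hV ^ m) (delta k)) n‖ₑ ≤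
      ENNReal.ofReal (Real.exp (growthRate d B * |t|)) := by
  rw [ENNReal.tsum_comm, ← tsum_ofReal_exp_series _ _ (growthRate_nonneg hB)]
  refine ENNReal.tsum_le_tsum fun m => ?_
  refine le_trans (le_of_eq ?_) (mul_le_mul_right (expMass_hamiltonian_pow_le hV hB hVB k m) _)
  rw [expMass, ← ENNReal.tsum_mul_left]
  congr 1; ext n
  rw [enorm_mul, enorm_coeff]
  ring

-- With K the growth rate, this is finite speed of propagation: the ℓ¹ mass beyond distance r from k
-- is at most e^{K|t| - r}.
variable {V} in
theorem expMass_wave_le {B : ℝ} (hB : 0 ≤ B) (hVB : ∀ n, |V n| ≤ B) (k : Fin d → ℤ) (t : ℝ) :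
    expMass k (wave V hV k t) ≤ ENNReal.ofReal (Real.exp (growthRate d B * |t|)) := by
  refine le_trans (ENNReal.tsum_le_tsum fun n => ?_) (tsum_tsum_enorm_le hV hB hVB k t)
  rw [ENNReal.tsum_mul_left, ← (hasSum_wave V hV k t n).tsum_eq]
  exact mul_le_mul_right enorm_tsum_le_tsum_enorm _

/-! ### Pairing with generalized eigenfunctions -/

theorem summable_mul_of_expMass {k : Fin d → ℤ} {ψ f : (Fin d → ℤ) → ℂ} {C : ℝ}
    (hψ : ∀ n, ‖ψ n‖ ≤ C * Real.exp ‖n - k‖) (hf : expMass k f ≠ ⊤) :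
    Summable fun n => ψ n * f n := by
  refine Summable.of_enorm (ne_top_of_le_ne_top (b := ENNReal.ofReal C * expMass k f)
    (ENNReal.mul_ne_top ENNReal.ofReal_ne_top hf) ?_)
  · rw [expMass, ← ENNReal.tsum_mul_left]
    refine ENNReal.tsum_le_tsum fun n => ?_
    rw [enorm_mul, ← mul_assoc]
    refine mul_le_mul_left ?_ _
    have hC : 0 ≤ C := by
      by_contra h
      have := (norm_nonneg _).trans (hψ n)
      have := mul_neg_of_neg_of_pos (not_le.mp h) (Real.exp_pos ‖n - k‖)
      linarith
    rw [← ofReal_norm, ← ENNReal.ofReal_mul hC]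
    exact ENNReal.ofReal_le_ofReal (hψ n)

/-- The difference expression is symmetric for the bilinear pairing. -/
theorem tsum_mul_diffExpr {B : ℝ} (hB : 0 ≤ B) (hVB : ∀ n, |V n| ≤ B)
    {k : Fin d → ℤ} {ψ f : (Fin d → ℤ) → ℂ} {C : ℝ}
    (hψ : ∀ n, ‖ψ n‖ ≤ C * Real.exp ‖n - k‖) (hf : expMass k f ≠ ⊤) :
    ∑' n, ψ n * diffExpr V f n = ∑' n, diffExpr V ψ n * f n := by
  have hs : ∀ a : Fin d → ℤ, ‖a‖ ≤ 1 → Summable fun n => ψ n * f (n + a) := fun a ha =>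
    summable_mul_of_expMass hψ (ne_top_of_le_ne_top
      (ENNReal.mul_ne_top ENNReal.ofReal_ne_top hf) (expMass_shift_le k a ha f))
  have hsh : ∀ a : Fin d → ℤ, ‖a‖ ≤ 1 →
      HasSum (fun n => ψ (n - a) * f n) (∑' n, ψ n * f (n + a)) := fun a ha => by
    rw [← (Equiv.addRight a).hasSum_iff]
    simpa [Function.comp_def] using (hs a ha).hasSum
  have h1 : ∀ i : Fin d, ‖(Pi.single i 1 : Fin d → ℤ)‖ ≤ 1 := norm_single_le_one
  have h2 : ∀ i : Fin d, ‖-(Pi.single i 1 : Fin d → ℤ)‖ ≤ 1 := fun i => by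
    rw [norm_neg]; exact h1 i
  have hV' : Summable fun n => (V n : ℂ) * ψ n * f n := by
    refine summable_mul_of_expMass (C := B * C) (fun n => ?_) hf
    rw [norm_mul, Complex.norm_real, mul_assoc]
    exact mul_le_mul (hVB n) (hψ n) (norm_nonneg _) hB
  have hL : HasSum (fun n => ψ n * diffExpr V f n)
      ((∑ i : Fin d, ((∑' n, ψ n * f (n + Pi.single i 1)) + ∑' n, ψ n * f (n + -Pi.single i 1)))
        + ∑' n, (V n : ℂ) * ψ n * f n) := by
    convert! (hasSum_sum fun i (_ : i ∈ Finset.univ) =>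
      ((hs _ (h1 i)).hasSum.add (hs _ (h2 i)).hasSum)).add hV'.hasSum using 2 with n
    rw [diffExpr, mul_add, Finset.mul_sum]
    congr 1
    · exact Finset.sum_congr rfl fun i _ => by rw [sub_eq_add_neg]; ring
    · ring
  have hR : HasSum (fun n => diffExpr V ψ n * f n)
      ((∑ i : Fin d, ((∑' n, ψ n * f (n + Pi.single i 1)) + ∑' n, ψ n * f (n + -Pi.single i 1)))
        + ∑' n, (V n : ℂ) * ψ n * f n) := by
    convert! (hasSum_sum fun i (_ : i ∈ Finset.univ) =>
      ((hsh _ (h1 i)).add (hsh _ (h2 i)))).add hV'.hasSum using 2 with n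
    rw [diffExpr, add_mul, Finset.sum_mul]
    congr 1
    exact Finset.sum_congr rfl fun i _ => by rw [sub_neg_eq_add]; ring
  rw [hL.tsum_eq, hR.tsum_eq]

variable {V} in
theorem tsum_mul_hamiltonian_pow {k : Fin d → ℤ} {ψ : (Fin d → ℤ) → ℂ} {C : ℝ} {E : ℂ}
    (hψ : ∀ n, ‖ψ n‖ ≤ C * Real.exp ‖n - k‖) (hE : ∀ n, diffExpr V ψ n = E * ψ n) (m : ℕ) :
    ∑' n, ψ n * ((hamiltonian V hV ^ m) (delta k)) n = E ^ m * ψ k := by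
  obtain ⟨B, hVB⟩ := hV
  have hB : 0 ≤ B := (abs_nonneg _).trans (hVB 0)
  induction m with
  | zero =>
    rw [tsum_eq_single k]
    · simp [delta_apply]
    · intro n hn; simp [delta_apply, hn]
  | succ m ih =>
    rw [hamiltonian_pow_succ_apply, tsum_mul_diffExpr V hB hVB hψ]
    · simp only [hE, mul_assoc, tsum_mul_left, ih, pow_succ]
      ring
    · exact ne_top_of_le_ne_top (ENNReal.pow_ne_top ENNReal.ofReal_ne_top)
        (expMass_hamiltonian_pow_le ⟨B, hVB⟩ hB hVB k m)

variable {V} in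
/-- A generalized eigenfunction paired with the evolved `δ_k` only picks up a phase. -/
theorem hasSum_eigenfunction_mul_wave {k : Fin d → ℤ} {ψ : (Fin d → ℤ) → ℂ} {C : ℝ} {E : ℂ}
    (hψ : ∀ n, ‖ψ n‖ ≤ C * Real.exp ‖n - k‖) (hE : ∀ n, diffExpr V ψ n = E * ψ n) (t : ℝ) :
    HasSum (fun n => ψ n * wave V hV k t n) (Complex.exp (-Complex.I * t * E) * ψ k) := by
  obtain ⟨B, hVB⟩ := id hV
  have hB : 0 ≤ B := (abs_nonneg _).trans (hVB 0)
  set c : ℕ → ℂ := fun m => (m.factorial : ℂ)⁻¹ * (-Complex.I * t) ^ m with hc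
  set a : ℕ → (Fin d → ℤ) → ℂ := fun m => ⇑((hamiltonian V hV ^ m) (delta k)) with ha
  have hsum : Summable (Function.uncurry fun n m => ψ n * (c m * a m n)) := by
    refine Summable.of_enorm ?_
    rw [ENNReal.tsum_prod']
    refine ne_top_of_le_ne_top (ENNReal.mul_ne_top ENNReal.ofReal_ne_top ENNReal.ofReal_ne_top)
      (b := ENNReal.ofReal C * ENNReal.ofReal (Real.exp (growthRate d B * |t|))) ?_
    refine le_trans ?_ (mul_le_mul_right (tsum_tsum_enorm_le hV hB hVB k t) _)
    rw [← ENNReal.tsum_mul_left]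
    refine ENNReal.tsum_le_tsum fun n => ?_
    rw [← ENNReal.tsum_mul_left]
    refine ENNReal.tsum_le_tsum fun m => ?_
    simp only [Function.uncurry]
    rw [enorm_mul, ← mul_assoc]
    refine mul_le_mul_left ?_ _
    rw [← ENNReal.ofReal_mul' (Real.exp_pos _).le, ← ofReal_norm]
    exact ENNReal.ofReal_le_ofReal (hψ n)
  -- The double series is summed in both orders: over m first it gives the wave, over n first the
  -- exponential series in E.
  have h1 : ∀ n, ∑' m, ψ n * (c m * a m n) = ψ n * wave V hV k t n := fun n => by
    rw [tsum_mul_left, (hasSum_wave V hV k t n).tsum_eq]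
  have h2 : ∀ m, ∑' n, ψ n * (c m * a m n) = c m * (E ^ m * ψ k) := fun m => by
    rw [← tsum_mul_hamiltonian_pow hV hψ hE m, ← tsum_mul_left]
    exact tsum_congr fun n => by ring
  have h3 : ∑' m, c m * (E ^ m * ψ k) = Complex.exp (-Complex.I * t * E) * ψ k := by
    have h := NormedSpace.expSeries_div_hasSum_exp (-Complex.I * t * E)
    rw [← Complex.exp_eq_exp_ℂ] at h
    rw [← (h.mul_right (ψ k)).tsum_eq]
    refine tsum_congr fun m => ?_
    rw [mul_pow _ E]
    simp only [hc]; ring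
  rw [← h3, ← tsum_congr h2, hsum.tsum_comm, tsum_congr h1]
  refine Summable.hasSum ?_
  refine summable_mul_of_expMass hψ (ne_top_of_le_ne_top ENNReal.ofReal_ne_top
    (expMass_wave_le hV hB hVB k t))

end

/-! ### Unitarity of the evolution, and finiteness of the moments. -/

section

variable {d : ℕ}

theorem inner_shift_left (a : Fin d → ℤ) (u v : Ell2 d) :
    inner ℂ (shift a u) v = inner ℂ u (shift (-a) v) := by
  rw [lp.inner_eq_tsum, lp.inner_eq_tsum, ← (Equiv.addRight a).tsum_eq
    (fun n => inner ℂ (u n) (shift (-a) v n))]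
  refine tsum_congr fun n => ?_
  change inner ℂ (u (n + a)) (v n) = inner ℂ (u (n + a)) (v (n + a + -a))
  rw [add_neg_cancel_right]

theorem inner_potential_left (V : (Fin d → ℤ) → ℝ) (hV : ∃ B : ℝ, ∀ n, |V n| ≤ B) (u v : Ell2 d) :
    inner ℂ (potential V hV u) v = inner ℂ u (potential V hV v) := by
  rw [lp.inner_eq_tsum, lp.inner_eq_tsum]
  refine tsum_congr fun n => ?_
  change inner ℂ ((V n : ℂ) * u n) (v n) = inner ℂ (u n) ((V n : ℂ) * v n)
  simp only [RCLike.inner_apply, map_mul, Complex.conj_ofReal]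
  ring

variable (V : (Fin d → ℤ) → ℝ) (hV : ∃ B : ℝ, ∀ n, |V n| ≤ B)

theorem isSelfAdjoint_hamiltonian : IsSelfAdjoint (hamiltonian V hV) := by
  rw [ContinuousLinearMap.isSelfAdjoint_iff_isSymmetric]
  intro u v
  simp only [hamiltonian, ContinuousLinearMap.coe_coe, add_apply, sum_apply, inner_add_left,
    inner_add_right, sum_inner, inner_sum, inner_shift_left, inner_potential_left, neg_neg]
  congr 1
  exact Finset.sum_congr rfl fun i _ => add_comm _ _

theorem smul_hamiltonian_mem_skewAdjoint (t : ℝ) :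
    (-Complex.I * (t : ℂ)) • hamiltonian V hV ∈ skewAdjoint (Ell2 d →L[ℂ] Ell2 d) := by
  rw [skewAdjoint.mem_iff, star_smul, (isSelfAdjoint_hamiltonian V hV).star_eq, ← neg_smul]
  congr 1
  simp

theorem star_evolution (t : ℝ) : star (evolution V hV t) = evolution V hV (-t) := by
  rw [evolution, NormedSpace.star_exp, skewAdjoint.mem_iff.mp
    (smul_hamiltonian_mem_skewAdjoint V hV t), evolution, ← neg_smul]
  congr 2
  simp

theorem norm_evolution_apply (t : ℝ) (u : Ell2 d) : ‖evolution V hV t u‖ = ‖u‖ := by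
  let _ : NormedAlgebra ℚ (Ell2 d →L[ℂ] Ell2 d) := NormedAlgebra.restrictScalars ℚ ℂ _
  have h : evolution V hV t ∈ unitary (Ell2 d →L[ℂ] Ell2 d) :=
    NormedSpace.exp_mem_unitary_of_mem_skewAdjoint (smul_hamiltonian_mem_skewAdjoint V hV t)
  have h2 : inner ℂ (evolution V hV t u) (evolution V hV t u) = inner ℂ u u := by
    rw [← ContinuousLinearMap.adjoint_inner_right, ← ContinuousLinearMap.star_eq_adjoint,
      ← mul_apply_eq_comp, (Unitary.mem_iff.mp h).1]
    rfl
  rw [inner_self_eq_norm_sq_to_K, inner_self_eq_norm_sq_to_K] at h2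
  have h3 : ‖evolution V hV t u‖ ^ 2 = ‖u‖ ^ 2 := by exact_mod_cast h2
  exact (sq_eq_sq₀ (norm_nonneg _) (norm_nonneg _)).mp h3

theorem norm_wave (k : Fin d → ℤ) (t : ℝ) : ‖wave V hV k t‖ = 1 := by
  rw [wave, norm_evolution_apply, delta, lp.norm_single (by norm_num)]
  simp

theorem norm_wave_apply_le (k n : Fin d → ℤ) (t : ℝ) : ‖wave V hV k t n‖ ≤ 1 := by
  rw [← norm_wave V hV k t]
  exact lp.norm_apply_le_norm (by norm_num) _ n

theorem enorm_wave_apply_le (k n : Fin d → ℤ) (t : ℝ) : ‖wave V hV k t n‖ₑ ≤ 1 := by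
  rw [← ofReal_norm, ← ENNReal.ofReal_one]
  exact ENNReal.ofReal_le_ofReal (norm_wave_apply_le V hV k n t)

theorem tsum_enorm_wave_sq (k : Fin d → ℤ) (t : ℝ) : ∑' n, ‖wave V hV k t n‖ₑ ^ 2 = 1 := by
  have h := lp.hasSum_norm (p := 2) (by norm_num) (wave V hV k t)
  simp only [norm_wave, ENNReal.toReal_ofNat, Real.rpow_ofNat, one_pow] at h
  have h2 := ENNReal.ofReal_tsum_of_nonneg (fun n => sq_nonneg _) h.summable
  rw [h.tsum_eq, ENNReal.ofReal_one] at h2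
  rw [h2]
  refine tsum_congr fun n => ?_
  rw [ENNReal.ofReal_pow (norm_nonneg _), ofReal_norm]

theorem continuous_wave (k : Fin d → ℤ) : Continuous (wave V hV k) := by
  let _ : NormedAlgebra ℚ (Ell2 d →L[ℂ] Ell2 d) := NormedAlgebra.restrictScalars ℚ ℂ _
  have h : Continuous (evolution V hV) := by
    refine NormedSpace.exp_continuous.comp ?_
    fun_prop
  exact h.clm_apply continuous_const

theorem continuous_wave_apply (k n : Fin d → ℤ) : Continuous fun t => wave V hV k t n :=
  (lp.evalCLM ℂ (fun _ : Fin d → ℤ => ℂ) 2 n).continuous.comp (continuous_wave V hV k)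

/-! ### Subexponential weights -/

theorem exists_rpow_le_mul_add {b η : ℝ} (hb0 : 0 ≤ b) (hb1 : b < 1) (hη : 0 < η) :
    ∃ c : ℝ, 0 ≤ c ∧ ∀ x : ℝ, 0 ≤ x → x ^ b ≤ η * x + c := by
  -- R is the positive point where x^b meets the line η x; beyond it the line dominates, and before
  -- it x^b ≤ R^b.
  set R := η ^ (1 / (b - 1)) with hR
  have hRpos : 0 < R := Real.rpow_pos_of_pos hη _
  have hRη : R ^ (b - 1) = η := by
    rw [hR, ← Real.rpow_mul hη.le, one_div, inv_mul_cancel₀ (by linarith), Real.rpow_one]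
  refine ⟨R ^ b, (Real.rpow_pos_of_pos hRpos b).le, fun x hx => ?_⟩
  rcases le_total x R with h | h
  · have := Real.rpow_le_rpow hx h hb0
    nlinarith [mul_nonneg hη.le hx]
  · have hx' : 0 < x := hRpos.trans_le h
    have h1 : x ^ (b - 1) ≤ R ^ (b - 1) :=
      Real.rpow_le_rpow_of_nonpos hRpos h (by linarith)
    have h2 : x ^ b = x ^ (b - 1) * x := by
      rw [← Real.rpow_add_one hx'.ne', sub_add_cancel]
    rw [h2]
    have := mul_le_mul_of_nonneg_right (h1.trans_eq hRη) hx
    linarith [Real.rpow_pos_of_pos hRpos b]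

theorem one_le_norm_of_ne_zero {n : Fin d → ℤ} (hn : n ≠ 0) : 1 ≤ ‖n‖ := by
  obtain ⟨i, hi⟩ := Function.ne_iff.mp hn
  refine le_trans ?_ (norm_le_pi_norm n i)
  rw [Int.norm_eq_abs]
  exact_mod_cast Int.one_le_abs hi

theorem HasSubexpGrowth.exists_le {φ : (Fin d → ℤ) → ℝ} (hφ : HasSubexpGrowth φ)
    (k : Fin d → ℤ) {η : ℝ} (hη : 0 < η) :
    ∃ C : ℝ, 0 < C ∧ ∀ n, φ n ≤ C * Real.exp (η * ‖n - k‖) := by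
  obtain ⟨C, β, hβ, h⟩ := hφ
  obtain ⟨c, hc, hx⟩ := exists_rpow_le_mul_add (le_max_right β 0) (max_lt hβ one_pos) hη
  have h1 : ∀ n : Fin d → ℤ, ‖n‖ ^ β ≤ η * ‖n - k‖ + (η * ‖k‖ + c + 1) := fun n => by
    have h2 : ‖n‖ ≤ ‖n - k‖ + ‖k‖ := by simpa using norm_add_le (n - k) k
    have h2' := mul_le_mul_of_nonneg_left h2 hη.le
    -- β may be negative, hence the maximum. Off the origin ‖n‖ ≥ 1 on the lattice, so the power
    -- increases with the exponent; the summand 1 covers n = 0.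
    have h3 : ‖n‖ ^ β ≤ ‖n‖ ^ (max β 0) + 1 := by
      rcases eq_or_ne n 0 with rfl | hn
      · rw [norm_zero]
        exact (Real.zero_rpow_le_one β).trans (by linarith [Real.rpow_nonneg le_rfl (max β 0)])
      · linarith [Real.rpow_le_rpow_of_exponent_le (one_le_norm_of_ne_zero hn) (le_max_left β 0)]
    linarith [hx ‖n‖ (norm_nonneg _)]
  refine ⟨(|C| + 1) * Real.exp (η * ‖k‖ + c + 1), by positivity, fun n => (h n).trans ?_⟩
  rw [mul_assoc, ← Real.exp_add]
  refine mul_le_mul (by linarith [le_abs_self C]) (Real.exp_le_exp.mpr ?_) (Real.exp_pos _).le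
    (by positivity)
  linarith [h1 n]

/-! ### The expectation -/

variable {V hV}

/-- Since φ is at most a multiple of the weight in `expMass`, the product of φ and the wave is in
ℓ¹, hence in ℓ². -/
theorem inDomain_wave {φ : (Fin d → ℤ) → ℝ} (hφ_pos : ∀ n, 0 < φ n) (hφ : HasSubexpGrowth φ)
    (k : Fin d → ℤ) (t : ℝ) : InDomain φ (wave V hV k t) := by
  obtain ⟨B, hVB⟩ := id hV
  have hB : 0 ≤ B := (abs_nonneg _).trans (hVB 0)
  obtain ⟨C, -, hC⟩ := hφ.exists_le k one_pos
  have hs : Summable fun n => (φ n : ℂ) * wave V hV k t n := by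
    refine summable_mul_of_expMass (k := k) (C := C) (fun n => ?_) (ne_top_of_le_ne_top
      ENNReal.ofReal_ne_top (expMass_wave_le hV hB hVB k t))
    rw [Complex.norm_real, Real.norm_of_nonneg (hφ_pos n).le]
    simpa using hC n
  refine Memℓp.of_exponent_ge (p := 2) (q := 1) (memℓp_gen ?_) (by norm_num)
  simpa using hs.norm

theorem hasSum_expectation {φ : (Fin d → ℤ) → ℝ} {k : Fin d → ℤ} {t : ℝ}
    (h : InDomain φ (wave V hV k t)) :
    HasSum (fun n => φ n * ‖wave V hV k t n‖ ^ 2) (expectation V hV φ k t) := by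
  have h1 : expectation V hV φ k t =
      (inner ℂ (wave V hV k t) (mulOp φ (wave V hV k t))).re := by
    rw [expectation, ← star_evolution, ContinuousLinearMap.star_eq_adjoint,
      ContinuousLinearMap.adjoint_inner_right]
    rfl
  rw [h1]
  have h2 := Complex.hasSum_re (lp.hasSum_inner (wave V hV k t) (mulOp φ (wave V hV k t)))
  convert! h2 using 2 with n
  rw [mulOp, dif_pos h]
  change _ = (inner ℂ (wave V hV k t n) ((φ n : ℂ) * wave V hV k t n)).re
  rw [RCLike.inner_apply, mul_assoc, Complex.mul_conj, ← Complex.ofReal_mul, Complex.ofReal_re,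
    Complex.normSq_eq_norm_sq]

theorem expectation_nonneg {φ : (Fin d → ℤ) → ℝ} (hφ_pos : ∀ n, 0 < φ n)
    (hφ : HasSubexpGrowth φ) (k : Fin d → ℤ) (t : ℝ) : 0 ≤ expectation V hV φ k t :=
  (hasSum_expectation (inDomain_wave hφ_pos hφ k t)).nonneg fun n =>
    mul_nonneg (hφ_pos n).le (sq_nonneg _)

theorem ofReal_expectation {φ : (Fin d → ℤ) → ℝ} (hφ_pos : ∀ n, 0 < φ n)
    (hφ : HasSubexpGrowth φ) (k : Fin d → ℤ) (t : ℝ) :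
    ENNReal.ofReal (expectation V hV φ k t) =
      ∑' n, ENNReal.ofReal (φ n) * ‖wave V hV k t n‖ₑ ^ 2 := by
  have h := hasSum_expectation (inDomain_wave (V := V) (hV := hV) hφ_pos hφ k t)
  rw [← h.tsum_eq, ENNReal.ofReal_tsum_of_nonneg
    (fun n => mul_nonneg (hφ_pos n).le (sq_nonneg _)) h.summable]
  refine tsum_congr fun n => ?_
  rw [ENNReal.ofReal_mul (hφ_pos n).le, ENNReal.ofReal_pow (norm_nonneg _), ofReal_norm]

theorem measurable_expectation {φ : (Fin d → ℤ) → ℝ} (hφ_pos : ∀ n, 0 < φ n)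
    (hφ : HasSubexpGrowth φ) (k : Fin d → ℤ) : Measurable (expectation V hV φ k) := by
  have h : expectation V hV φ k =
      fun t => (∑' n, ENNReal.ofReal (φ n) * ‖wave V hV k t n‖ₑ ^ 2).toReal := by
    ext t
    rw [← ofReal_expectation hφ_pos hφ, ENNReal.toReal_ofReal (expectation_nonneg hφ_pos hφ k t)]
  rw [h]
  refine ENNReal.measurable_toReal.comp (Measurable.tsum fun n => ?_)
  exact ((continuous_wave_apply V hV k n).measurable.enorm.pow_const 2).const_mul _

/-- Ballistic upper bound: `φ(X)` spreads at an arbitrarily small exponential rate. -/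
theorem expectation_le {φ : (Fin d → ℤ) → ℝ} (hφ_pos : ∀ n, 0 < φ n)
    (hφ : HasSubexpGrowth φ) {B : ℝ} (hB : 0 ≤ B) (hVB : ∀ n, |V n| ≤ B) {k : Fin d → ℤ}
    {C η : ℝ} (hC : 0 < C) (hη : η ≤ 1 / 2) (hη0 : 0 ≤ η)
    (hφC : ∀ n, φ n ≤ C * Real.exp (η * ‖n - k‖)) {t : ℝ} (ht : 0 ≤ t) :
    expectation V hV φ k t ≤ C * (Real.exp (2 * growthRate d B * η * t) + 1) := by
  set K := growthRate d B with hK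
  have hK0 : 0 ≤ K := growthRate_nonneg hB
  have hpt : ∀ n, ENNReal.ofReal (φ n) * ‖wave V hV k t n‖ₑ ^ 2 ≤
      ENNReal.ofReal C * (ENNReal.ofReal (Real.exp (2 * K * η * t)) * ‖wave V hV k t n‖ₑ ^ 2 +
        ENNReal.ofReal (Real.exp (-(K * t))) *
          (ENNReal.ofReal (Real.exp ‖n - k‖) * ‖wave V hV k t n‖ₑ)) := fun n => by
    have h1 : ENNReal.ofReal (φ n) ≤
        ENNReal.ofReal C * ENNReal.ofReal (Real.exp (η * ‖n - k‖)) := by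
      rw [← ENNReal.ofReal_mul hC.le]
      exact ENNReal.ofReal_le_ofReal (hφC n)
    refine (mul_le_mul_left h1 _).trans ?_
    rw [mul_assoc]
    refine mul_le_mul_right ?_ _
    -- Inside radius 2Kt the weight is at most e^{2Kηt} and the total probability is 1. Outside,
    -- |u|² ≤ |u| and, as η ≤ 1/2, e^{ηr} ≤ e^{-Kt} e^{r}; the factor e^{-Kt} cancels the growth of
    -- `expMass`.
    rcases le_total ‖n - k‖ (2 * K * t) with h | h
    · refine le_add_right (mul_le_mul_left (ENNReal.ofReal_le_ofReal
        (Real.exp_le_exp.mpr ?_)) _)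
      nlinarith [mul_le_mul_of_nonneg_left h hη0]
    · refine le_add_left ?_
      rw [← mul_assoc, ← ENNReal.ofReal_mul (Real.exp_pos _).le, ← Real.exp_add, sq]
      refine mul_le_mul' (ENNReal.ofReal_le_ofReal (Real.exp_le_exp.mpr ?_)) ?_
      · nlinarith [mul_le_mul_of_nonneg_right hη (norm_nonneg (n - k))]
      · exact mul_le_of_le_one_left' (enorm_wave_apply_le V hV k n t)
  have h2 : ENNReal.ofReal (expectation V hV φ k t) ≤
      ENNReal.ofReal (C * (Real.exp (2 * K * η * t) + 1)) := by
    rw [ofReal_expectation hφ_pos hφ]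
    refine (ENNReal.tsum_le_tsum hpt).trans ?_
    rw [ENNReal.tsum_mul_left, ENNReal.tsum_add, ENNReal.tsum_mul_left, ENNReal.tsum_mul_left,
      tsum_enorm_wave_sq, mul_one, ENNReal.ofReal_mul hC.le,
      ENNReal.ofReal_add (Real.exp_pos _).le zero_le_one]
    refine mul_le_mul_right (add_le_add_right ?_ _) _
    refine (mul_le_mul_right (expMass_wave_le hV hB hVB k t) _).trans (le_of_eq ?_)
    rw [← ENNReal.ofReal_mul (Real.exp_pos _).le, ← Real.exp_add, abs_of_nonneg ht, ← hK,
      neg_add_cancel, Real.exp_zero]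
  exact (ENNReal.ofReal_le_ofReal_iff (by positivity)).mp h2

theorem integrableOn_expectation {φ : (Fin d → ℤ) → ℝ} (hφ_pos : ∀ n, 0 < φ n)
    (hφ : HasSubexpGrowth φ) (k : Fin d → ℤ) {T : ℝ} (hT : 0 < T) :
    IntegrableOn (fun t => Real.exp (-(t / T)) * expectation V hV φ k t) (Set.Ioi (0 : ℝ)) := by
  obtain ⟨B, hVB⟩ := id hV
  have hB : 0 ≤ B := (abs_nonneg _).trans (hVB 0)
  set K := growthRate d B with hK
  have hK0 : 0 ≤ K := growthRate_nonneg hB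
  -- This makes the growth rate 2Kη at most 1/(2T), half the damping rate 1/T.
  set η := min (1 / 2) (1 / (4 * (K + 1) * T)) with hη
  have hη0 : 0 < η := lt_min (by norm_num) (by positivity)
  have hη1 : 2 * K * η ≤ 1 / (2 * T) := by
    have h1 : η ≤ 1 / (4 * (K + 1) * T) := min_le_right _ _
    calc 2 * K * η ≤ 2 * (K + 1) * (1 / (4 * (K + 1) * T)) := by gcongr; linarith
      _ = 1 / (2 * T) := by field_simp; norm_num
  obtain ⟨C, hC, hφC⟩ := hφ.exists_le k hη0
  have hdom : IntegrableOn (fun t : ℝ => C * Real.exp (-(1 / (2 * T)) * t) +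
      C * Real.exp (-(1 / T) * t)) (Set.Ioi 0) :=
    ((exp_neg_integrableOn_Ioi 0 (by positivity)).const_mul C).add
      ((exp_neg_integrableOn_Ioi 0 (by positivity)).const_mul C)
  refine Integrable.mono' hdom ?_ ?_
  · exact ((by fun_prop : Measurable fun t : ℝ => Real.exp (-(t / T))).mul
      (measurable_expectation hφ_pos hφ k)).aestronglyMeasurable
  · filter_upwards [ae_restrict_mem measurableSet_Ioi] with t ht
    have ht0 : 0 ≤ t := le_of_lt ht
    rw [norm_mul, Real.norm_of_nonneg (Real.exp_pos _).le,
      Real.norm_of_nonneg (expectation_nonneg hφ_pos hφ k t)]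
    have h1 := expectation_le (hV := hV) hφ_pos hφ hB hVB hC (min_le_left _ _) hη0.le hφC ht0
    refine (mul_le_mul_of_nonneg_left h1 (Real.exp_pos _).le).trans ?_
    have h2 : Real.exp (-(t / T)) * Real.exp (2 * K * η * t) ≤
        Real.exp (-(1 / (2 * T)) * t) := by
      rw [← Real.exp_add]
      refine Real.exp_le_exp.mpr ?_
      have h3 := mul_le_mul_of_nonneg_right hη1 ht0
      have h4 : t / T = 2 * (1 / (2 * T) * t) := by field_simp
      rw [h4]; linarith
    have h5 : Real.exp (-(t / T)) = Real.exp (-(1 / T) * t) := by congr 1; ring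
    calc Real.exp (-(t / T)) * (C * (Real.exp (2 * K * η * t) + 1))
        = C * (Real.exp (-(t / T)) * Real.exp (2 * K * η * t)) + C * Real.exp (-(t / T)) := by ring
      _ ≤ _ := by rw [← h5]; gcongr

end

/-! ### Half-line Green's function and Plancherel in the energy. -/

section

variable {d : ℕ} (V : (Fin d → ℤ) → ℝ) (hV : ∃ B : ℝ, ∀ n, |V n| ≤ B)

/-- The half-line transform `∫₀^∞ e^{(iE-ε)t} ⟨δ_n, e^{-itH} δ_k⟩ dt`, a multiple of the Green's
function `⟨δ_n, (H - E - iε)⁻¹ δ_k⟩`. -/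
def green (k : Fin d → ℤ) (ε E : ℝ) (n : Fin d → ℤ) : ℂ :=
  ∫ t in Set.Ioi (0 : ℝ), Complex.exp ((Complex.I * E - ε) * t) * wave V hV k t n

/-- The function `e^{-εt} ⟨δ_n, e^{-itH} δ_k⟩` on the half-line, extended by zero. -/
def dampedWave (k : Fin d → ℤ) (ε : ℝ) (n : Fin d → ℤ) : ℝ → ℂ :=
  Set.indicator (Set.Ioi 0) fun t => (Real.exp (-ε * t) : ℂ) * wave V hV k t n

theorem norm_exp_mul_wave_le (k n : Fin d → ℤ) (ε E t : ℝ) :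
    ‖Complex.exp ((Complex.I * E - ε) * t) * wave V hV k t n‖ ≤ Real.exp (-ε * t) := by
  rw [norm_mul, Complex.norm_exp]
  have h : ((Complex.I * E - ε) * t : ℂ).re = -ε * t := by simp
  rw [h]
  exact mul_le_of_le_one_right (Real.exp_pos _).le (norm_wave_apply_le V hV k n t)

theorem integrableOn_exp_mul_wave (k n : Fin d → ℤ) {ε : ℝ} (hε : 0 < ε) (E : ℝ) :
    IntegrableOn (fun t : ℝ => Complex.exp ((Complex.I * E - ε) * t) * wave V hV k t n)
      (Set.Ioi 0) := by
  refine Integrable.mono' (exp_neg_integrableOn_Ioi 0 hε) ?_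
    (Filter.Eventually.of_forall fun t => norm_exp_mul_wave_le V hV k n ε E t)
  exact (Continuous.mul (by fun_prop) (continuous_wave_apply V hV k n)).aestronglyMeasurable

theorem integrable_dampedWave (k n : Fin d → ℤ) {ε : ℝ} (hε : 0 < ε) :
    Integrable (dampedWave V hV k ε n) := by
  rw [dampedWave, integrable_indicator_iff measurableSet_Ioi]
  refine (integrableOn_exp_mul_wave V hV k n hε 0).congr_fun (fun t _ => ?_) measurableSet_Ioi
  simp

theorem norm_dampedWave_le_one (k n : Fin d → ℤ) {ε : ℝ} (hε : 0 < ε) (t : ℝ) :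
    ‖dampedWave V hV k ε n t‖ ≤ 1 := by
  rw [dampedWave, Set.indicator_apply]
  split_ifs with h
  · rw [norm_mul, Complex.norm_real, Real.norm_of_nonneg (Real.exp_pos _).le]
    refine mul_le_one₀ (Real.exp_le_one_iff.mpr ?_) (norm_nonneg _) (norm_wave_apply_le V hV k n t)
    have := mul_pos hε (Set.mem_Ioi.mp h)
    linarith
  · simp

theorem memLp_dampedWave (k n : Fin d → ℤ) {ε : ℝ} (hε : 0 < ε) :
    MemLp (dampedWave V hV k ε n) 2 := by
  have h := integrable_dampedWave V hV k n hε
  rw [memLp_two_iff_integrable_sq_norm h.aestronglyMeasurable]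
  refine h.norm.mono' (h.aestronglyMeasurable.norm.pow 2) (Filter.Eventually.of_forall fun t => ?_)
  rw [norm_pow, norm_norm, sq]
  exact mul_le_of_le_one_left (norm_nonneg _) (norm_dampedWave_le_one V hV k n hε t)

-- The kernel e^{-2πitξ} corresponds to the energy E = -2πξ, the source of the factor 2π in
-- Plancherel's identity below.
open scoped FourierTransform in
theorem fourier_dampedWave (k n : Fin d → ℤ) (ε ξ : ℝ) :
    𝓕 (dampedWave V hV k ε n) ξ = green V hV k ε (-(2 * Real.pi) * ξ) n := by
  rw [Real.fourier_real_eq_integral_exp_smul, green, ← integral_indicator measurableSet_Ioi]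
  congr 1; ext t
  rw [dampedWave, ← Set.indicator_smul_apply (Set.Ioi 0)
    (fun v : ℝ => Complex.exp (↑(-2 * Real.pi * v * ξ) * Complex.I))]
  refine congrFun (congrArg _ ?_) t
  ext s
  rw [smul_eq_mul, ← mul_assoc, Complex.ofReal_exp, ← Complex.exp_add]
  congr 2
  push_cast
  ring

open scoped FourierTransform in
theorem continuous_green (k n : Fin d → ℤ) {ε : ℝ} (hε : 0 < ε) :
    Continuous fun E => green V hV k ε E n := by
  have hcont : Continuous (𝓕 (dampedWave V hV k ε n)) :=
    VectorFourier.fourierIntegral_continuous (L := innerₗ ℝ) Real.continuous_fourierChar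
      continuous_inner (integrable_dampedWave V hV k n hε)
  have h : (fun E => green V hV k ε E n) =
      fun E => 𝓕 (dampedWave V hV k ε n) (E / -(2 * Real.pi)) := by
    ext E
    rw [fourier_dampedWave, mul_div_cancel₀]
    have := Real.pi_pos
    linarith
  rw [h]
  exact hcont.comp (by fun_prop)

/-- Plancherel's identity in the energy variable. -/
theorem lintegral_enorm_green_sq (k n : Fin d → ℤ) {ε : ℝ} (hε : 0 < ε) :
    ∫⁻ E, ‖green V hV k ε E n‖ₑ ^ 2 = ENNReal.ofReal (2 * Real.pi) *
      ∫⁻ t in Set.Ioi (0 : ℝ), ENNReal.ofReal (Real.exp (-(2 * ε) * t)) *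
        ‖wave V hV k t n‖ₑ ^ 2 := by
  have hpi : -(2 * Real.pi) ≠ 0 := by have := Real.pi_pos; linarith
  have h1 : ∫⁻ t in Set.Ioi (0 : ℝ), ENNReal.ofReal (Real.exp (-(2 * ε) * t)) *
        ‖wave V hV k t n‖ₑ ^ 2 = ∫⁻ t, ‖dampedWave V hV k ε n t‖ₑ ^ 2 := by
    rw [← lintegral_indicator measurableSet_Ioi]
    congr 1; ext t
    rw [dampedWave, Set.indicator_apply, Set.indicator_apply]
    split_ifs
    · rw [enorm_mul, mul_pow]
      congr 1
      rw [← ofReal_norm, Complex.norm_real, Real.norm_of_nonneg (Real.exp_pos _).le,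
        ← ENNReal.ofReal_pow (Real.exp_pos _).le, ← Real.exp_nat_mul]
      congr 2; push_cast; ring
    · simp
  rw [h1, ← lintegral_enorm_fourier_sq (integrable_dampedWave V hV k n hε)
    (memLp_dampedWave V hV k n hε)]
  conv_lhs => rw [← Real.smul_map_volume_mul_left hpi]
  rw [lintegral_smul_measure, lintegral_map
    (((continuous_green V hV k n hε).measurable.enorm).pow_const 2) (measurable_const_mul _),
    abs_neg, abs_of_pos (by positivity), smul_eq_mul]
  simp only [fourier_dampedWave]

variable {V hV}

/-- The time-averaged moment dominates the energy integral of the Green's function over any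
finite set of sites. -/
theorem le_moment {φ : (Fin d → ℤ) → ℝ} (hφ_pos : ∀ n, 0 < φ n) (hφ : HasSubexpGrowth φ)
    (k : Fin d → ℤ) {T : ℝ} (hT : 0 < T) (S : Finset (Fin d → ℤ)) :
    ENNReal.ofReal (1 / (2 * Real.pi * T)) *
      ∫⁻ E, ∑ n ∈ S, ENNReal.ofReal (φ n) * ‖green V hV k (1 / (2 * T)) E n‖ₑ ^ 2 ≤
      ENNReal.ofReal (moment V hV φ k T) := by
  -- With ε = 1/(2T) the squared damping e^{-2εt} is exactly the averaging weight e^{-t/T}.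
  have hε : 0 < 1 / (2 * T) := by positivity
  have hpi := Real.pi_pos
  have hm : ∀ n, Measurable fun t => ENNReal.ofReal (Real.exp (-(t / T))) *
      ‖wave V hV k t n‖ₑ ^ 2 := fun n =>
    (by fun_prop : Measurable fun t : ℝ => ENNReal.ofReal (Real.exp (-(t / T)))).mul
      ((continuous_wave_apply V hV k n).measurable.enorm.pow_const 2)
  have h1 : ENNReal.ofReal (moment V hV φ k T) = ENNReal.ofReal (1 / T) *
      ∫⁻ t in Set.Ioi (0 : ℝ), ENNReal.ofReal (Real.exp (-(t / T))) *
        ∑' n, ENNReal.ofReal (φ n) * ‖wave V hV k t n‖ₑ ^ 2 := by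
    rw [moment, ENNReal.ofReal_mul (by positivity), ofReal_integral_eq_lintegral_ofReal
      (integrableOn_expectation hφ_pos hφ k hT) (Filter.Eventually.of_forall fun t =>
        mul_nonneg (Real.exp_pos _).le (expectation_nonneg hφ_pos hφ k t))]
    congr 2; ext t
    rw [ENNReal.ofReal_mul (Real.exp_pos _).le, ofReal_expectation hφ_pos hφ]
  have h2 : ∫⁻ E, ∑ n ∈ S, ENNReal.ofReal (φ n) * ‖green V hV k (1 / (2 * T)) E n‖ₑ ^ 2 =
      ENNReal.ofReal (2 * Real.pi) * ∫⁻ t in Set.Ioi (0 : ℝ),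
        ∑ n ∈ S, ENNReal.ofReal (φ n) * (ENNReal.ofReal (Real.exp (-(t / T))) *
          ‖wave V hV k t n‖ₑ ^ 2) := by
    rw [lintegral_finsetSum _ fun n _ =>
      (((continuous_green V hV k n hε).measurable.enorm).pow_const 2).const_mul _,
      lintegral_finsetSum _ fun n _ => (hm n).const_mul _, Finset.mul_sum]
    refine Finset.sum_congr rfl fun n _ => ?_
    rw [lintegral_const_mul _ (((continuous_green V hV k n hε).measurable.enorm).pow_const 2),
      lintegral_const_mul _ (hm n), lintegral_enorm_green_sq V hV k n hε, mul_left_comm]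
    congr 4; ext t; congr 3
    field_simp
  rw [h1, h2, ← mul_assoc, ← ENNReal.ofReal_mul (by positivity)]
  have h3 : 1 / (2 * Real.pi * T) * (2 * Real.pi) = 1 / T := by field_simp
  rw [h3]
  refine mul_le_mul_right (lintegral_mono fun t => ?_) _
  refine (ENNReal.sum_le_tsum S).trans (le_of_eq ?_)
  rw [← ENNReal.tsum_mul_left]
  exact tsum_congr fun n => mul_left_comm _ _ _

end

/-! ### Truncation of the pairing to a cube, and the pointwise lower bound in E. -/

section

variable {d : ℕ}

theorem card_cube (k : Fin d → ℤ) (L : ℕ) : (cube k L).card = (2 * L + 1) ^ d := by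
  classical
  rw [cube, Pi.card_Icc]
  have h : ∀ i : Fin d, (Finset.Icc (k i - (L : ℤ)) (k i + (L : ℤ))).card = 2 * L + 1 := fun i => by
    rw [Int.card_Icc]; omega
  simp [h]

theorem bracket_le (k n : Fin d → ℤ) : bracket n ≤ (1 + ‖k‖) * (1 + ‖n - k‖) := by
  have h1 : bracket n ≤ 1 + ‖n‖ := by
    rw [bracket, Real.sqrt_le_left (by positivity)]
    nlinarith [norm_nonneg n]
  have h2 : ‖n‖ ≤ ‖n - k‖ + ‖k‖ := by simpa using norm_add_le (n - k) k
  nlinarith [norm_nonneg k, norm_nonneg (n - k), mul_nonneg (norm_nonneg k) (norm_nonneg (n - k))]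

/-- The rate 1/2, not 1, keeps half of the exponential weight in reserve to produce the decay
e^{-L/2} outside the cube. -/
theorem one_add_pow_le_exp (m : ℕ) :
    ∃ c : ℝ, 0 < c ∧ ∀ x : ℝ, 0 ≤ x → (1 + x) ^ m ≤ c * Real.exp (x / 2) := by
  refine ⟨2 ^ m * m.factorial * Real.exp (1 / 2), by positivity, fun x hx => ?_⟩
  have h := Real.pow_div_factorial_le_exp ((1 + x) / 2) (by positivity) m
  rw [div_le_iff₀ (by positivity), div_pow, div_le_iff₀ (by positivity)] at h
  refine h.trans (le_of_eq ?_)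
  rw [show (1 + x) / 2 = 1 / 2 + x / 2 by ring, Real.exp_add]
  ring

variable {V : (Fin d → ℤ) → ℝ} (hV : ∃ B : ℝ, ∀ n, |V n| ≤ B)

/-- The defect made by truncating the pairing of an eigenfunction and the evolved `δ_k` to a cube,
with the phase removed. -/
def truncationDefect (k : Fin d → ℤ) (ψ : (Fin d → ℤ) → ℂ) (E : ℝ) (L : ℕ) (t : ℝ) : ℂ :=
  ψ k - Complex.exp (Complex.I * E * t) * ∑ n ∈ cube k L, ψ n * wave V hV k t n

theorem norm_truncationDefect_le_sum (k : Fin d → ℤ) (ψ : (Fin d → ℤ) → ℂ) (E : ℝ) (L : ℕ)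
    (t : ℝ) :
    ‖truncationDefect hV k ψ E L t‖ ≤ ‖ψ k‖ + ∑ n ∈ cube k L, ‖ψ n‖ := by
  refine (norm_sub_le _ _).trans (add_le_add_right ?_ _)
  rw [norm_mul, Complex.norm_exp]
  have h : (Complex.I * E * t : ℂ).re = 0 := by simp
  rw [h, Real.exp_zero, one_mul]
  refine (norm_sum_le _ _).trans (Finset.sum_le_sum fun n _ => ?_)
  rw [norm_mul]
  exact mul_le_of_le_one_right (norm_nonneg _) (norm_wave_apply_le V hV k n t)

/-- Uniform in time; used for late times, when the wave may have left the cube. -/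
theorem norm_truncationDefect_le_poly (k : Fin d → ℤ) {ψ : (Fin d → ℤ) → ℂ} {C : ℝ} {m : ℕ}
    (hC : 0 ≤ C) (hψ : ∀ n, ‖ψ n‖ ≤ C * (1 + ‖n - k‖) ^ m) (E : ℝ) (L : ℕ) (t : ℝ) :
    ‖truncationDefect hV k ψ E L t‖ ≤ 2 * C * (2 * L + 1) ^ (d + m) := by
  refine (norm_truncationDefect_le_sum hV k ψ E L t).trans ?_
  have hone : (1 : ℝ) ≤ 2 * L + 1 := by linarith [(Nat.cast_nonneg L : (0 : ℝ) ≤ L)]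
  have h1 : ‖ψ k‖ ≤ C * (2 * L + 1) ^ (d + m) := by
    have := hψ k
    rw [sub_self, norm_zero, add_zero, one_pow] at this
    exact this.trans (mul_le_mul_of_nonneg_left (one_le_pow₀ hone) hC)
  have h2 : ∑ n ∈ cube k L, ‖ψ n‖ ≤ C * (2 * L + 1) ^ (d + m) := by
    have h3 : ∀ n ∈ cube k L, ‖ψ n‖ ≤ C * (2 * L + 1) ^ m := fun n hn => by
      refine (hψ n).trans (mul_le_mul_of_nonneg_left (pow_le_pow_left₀ (by positivity) ?_ m) hC)
      have := (mem_cube k n L).mp hn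
      linarith [norm_nonneg (n - k)]
    refine (Finset.sum_le_card_nsmul _ _ _ h3).trans (le_of_eq ?_)
    rw [card_cube, nsmul_eq_mul, pow_add]
    push_cast
    ring
  linarith

/-- Used for early times. By the pairing identity the defect is a phase times the sum outside the
cube, where e^{r/2} ≤ e^{-L/2} e^{r}. -/
theorem norm_truncationDefect_le_exp {B : ℝ} (hB : 0 ≤ B) (hVB : ∀ n, |V n| ≤ B)
    (k : Fin d → ℤ) {ψ : (Fin d → ℤ) → ℂ} {C : ℝ} {E : ℝ}
    (hψ : ∀ n, ‖ψ n‖ ≤ C * Real.exp (‖n - k‖ / 2)) (hC : 0 ≤ C)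
    (hE : ∀ n, diffExpr V ψ n = E * ψ n) (L : ℕ) {t : ℝ} (ht : 0 ≤ t) :
    ‖truncationDefect hV k ψ E L t‖ ≤
      C * Real.exp (-(L / 2 : ℝ)) * Real.exp (growthRate d B * t) := by
  have hψ' : ∀ n, ‖ψ n‖ ≤ C * Real.exp ‖n - k‖ := fun n => (hψ n).trans
    (mul_le_mul_of_nonneg_left (Real.exp_le_exp.mpr (by linarith [norm_nonneg (n - k)])) hC)
  have hs := hasSum_eigenfunction_mul_wave hV hψ' hE t
  have h0 : Complex.exp (Complex.I * E * t) * Complex.exp (-Complex.I * t * E) = 1 := by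
    rw [← Complex.exp_add, ← Complex.exp_zero]
    congr 1; ring
  have h1 : truncationDefect hV k ψ E L t = Complex.exp (Complex.I * E * t) *
      ∑' n : {n // n ∉ cube k L}, ψ n * wave V hV k t n := by
    rw [truncationDefect]
    have h2 := hs.summable.sum_add_tsum_subtype_compl (cube k L)
    rw [hs.tsum_eq] at h2
    rw [eq_sub_of_add_eq' h2, mul_sub, ← mul_assoc, h0, one_mul]
  have hnorm : ‖Complex.exp (Complex.I * E * t)‖ₑ = 1 := by
    rw [← ofReal_norm, Complex.norm_exp]
    simp
  have h3 : ‖truncationDefect hV k ψ E L t‖ₑ ≤ ENNReal.ofReal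
      (C * Real.exp (-(L / 2 : ℝ)) * Real.exp (growthRate d B * t)) := by
    rw [h1, enorm_mul, hnorm, one_mul, ENNReal.ofReal_mul (by positivity)]
    refine enorm_tsum_le_tsum_enorm.trans ?_
    have h4 : ∀ n : {n // n ∉ cube k L}, ‖ψ n * wave V hV k t n‖ₑ ≤
        ENNReal.ofReal (C * Real.exp (-(L / 2 : ℝ))) *
          (ENNReal.ofReal (Real.exp ‖(n : Fin d → ℤ) - k‖) * ‖wave V hV k t n‖ₑ) := fun n => by
      rw [enorm_mul, ← mul_assoc, ← ENNReal.ofReal_mul (by positivity)]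
      refine mul_le_mul_left ?_ _
      rw [← ofReal_norm]
      refine ENNReal.ofReal_le_ofReal ((hψ n).trans ?_)
      rw [mul_assoc, ← Real.exp_add]
      refine mul_le_mul_of_nonneg_left (Real.exp_le_exp.mpr ?_) hC
      have := not_le.mp (mt (mem_cube k n L).mpr n.2)
      linarith
    refine (ENNReal.tsum_le_tsum h4).trans ?_
    rw [ENNReal.tsum_mul_left]
    refine mul_le_mul_right ?_ _
    refine (ENNReal.tsum_comp_le_tsum_of_injective Subtype.val_injective (fun n : Fin d → ℤ =>
      ENNReal.ofReal (Real.exp ‖n - k‖) * ‖wave V hV k t n‖ₑ)).trans ?_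
    have h5 := expMass_wave_le hV hB hVB k t
    rwa [abs_of_nonneg ht] at h5
  rw [← ofReal_norm] at h3
  exact (ENNReal.ofReal_le_ofReal_iff (by positivity)).mp h3

theorem sub_sum_green_eq (k : Fin d → ℤ) (ψ : (Fin d → ℤ) → ℂ) (E : ℝ) (L : ℕ) {ε : ℝ}
    (hε : 0 < ε) :
    ψ k - ε * ∑ n ∈ cube k L, ψ n * green V hV k ε E n =
      ε * ∫ t in Set.Ioi (0 : ℝ), (Real.exp (-ε * t) : ℂ) * truncationDefect hV k ψ E L t := by
  have h1 : ∀ t : ℝ, (Real.exp (-ε * t) : ℂ) * truncationDefect hV k ψ E L t =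
      (Real.exp (-ε * t) : ℂ) * ψ k - ∑ n ∈ cube k L,
        ψ n * (Complex.exp ((Complex.I * E - ε) * t) * wave V hV k t n) := fun t => by
    rw [truncationDefect, mul_sub, ← mul_assoc, Finset.mul_sum]
    congr 1
    refine Finset.sum_congr rfl fun n _ => ?_
    rw [Complex.ofReal_exp, ← Complex.exp_add,
      show (Complex.I * E - ε) * (t : ℂ) = ((-ε * t : ℝ) : ℂ) + Complex.I * E * t by
        push_cast; ring]
    ring
  have hint : ∀ n, IntegrableOn (fun t : ℝ => ψ n *
      (Complex.exp ((Complex.I * E - ε) * t) * wave V hV k t n)) (Set.Ioi 0) := fun n =>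
    (integrableOn_exp_mul_wave V hV k n hε E).const_mul _
  have hexp : ∫ t in Set.Ioi (0 : ℝ), (Real.exp (-ε * t) : ℂ) = (1 / ε : ℝ) := by
    rw [integral_complex_ofReal, integral_exp_mul_Ioi (by linarith)]
    simp
  have hI : ∫ t in Set.Ioi (0 : ℝ), (Real.exp (-ε * t) : ℂ) * truncationDefect hV k ψ E L t =
      (1 / ε : ℝ) * ψ k - ∑ n ∈ cube k L, ψ n * green V hV k ε E n := by
    refine (integral_congr_ae (Filter.Eventually.of_forall h1)).trans
      ((integral_sub ((exp_neg_integrableOn_Ioi 0 hε).ofReal.mul_const _)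
        (integrable_finsetSum _ fun n _ => hint n)).trans ?_)
    congr 1
    · rw [← hexp]
      exact integral_mul_const _ _
    · refine (integral_finsetSum _ fun n _ => hint n).trans (Finset.sum_congr rfl fun n _ => ?_)
      exact integral_const_mul _ _
  rw [hI, mul_sub, ← mul_assoc, ← Complex.ofReal_mul, mul_one_div_cancel hε.ne',
    Complex.ofReal_one, one_mul]

/-- Finite speed of propagation: up to a small error, an eigenfunction is reproduced from the
Green's function on a cube. -/
theorem norm_sub_sum_green_le {B : ℝ} (hB : 0 ≤ B) (hVB : ∀ n, |V n| ≤ B)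
    (k : Fin d → ℤ) {ψ : (Fin d → ℤ) → ℂ} {C₁ C₂ : ℝ} {m : ℕ} {E : ℝ} (hC₁ : 0 ≤ C₁) (hC₂ : 0 ≤ C₂)
    (hψ₁ : ∀ n, ‖ψ n‖ ≤ C₁ * Real.exp (‖n - k‖ / 2))
    (hψ₂ : ∀ n, ‖ψ n‖ ≤ C₂ * (1 + ‖n - k‖) ^ m)
    (hE : ∀ n, diffExpr V ψ n = E * ψ n) (L : ℕ) {ε : ℝ} (hε : 0 < ε) :
    ‖ψ k - ε * ∑ n ∈ cube k L, ψ n * green V hV k ε E n‖ ≤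
      C₁ * Real.exp (-(L / 4 : ℝ)) + 2 * (2 * C₂ * (2 * L + 1) ^ (d + m)) *
        Real.exp (-(ε * (L / (8 * (growthRate d B + 1))))) := by
  set K := growthRate d B with hK
  have hK0 : 0 ≤ K := growthRate_nonneg hB
  set P : ℝ := 2 * C₂ * (2 * L + 1) ^ (d + m) with hP
  have hP0 : 0 ≤ P := by positivity
  -- Crossover time. For t ≤ p one has Kt ≤ L/4, so the early bound is at most a multiple of
  -- e^{-L/4}. For t ≥ p, half of the damping supplies e^{-εp/2} and the other half keeps the
  -- integral finite.
  set p : ℝ := L / (4 * (K + 1)) with hp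
  have hKp : K * p ≤ L / 4 := by
    have : (K + 1) * p = L / 4 := by rw [hp]; field_simp
    have : 0 ≤ p := by positivity
    nlinarith
  have hbound : ∀ t : ℝ, 0 < t →
      ‖(Real.exp (-ε * t) : ℂ) * truncationDefect hV k ψ E L t‖ ≤
        C₁ * Real.exp (-(L / 4 : ℝ)) * Real.exp (-ε * t) +
          P * Real.exp (-(ε * p / 2)) * Real.exp (-(ε / 2) * t) := fun t ht => by
    rw [norm_mul, Complex.norm_real, Real.norm_of_nonneg (Real.exp_pos _).le]
    rcases le_total t p with h | h
    · have h1 := norm_truncationDefect_le_exp hV hB hVB k hψ₁ hC₁ hE L ht.le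
      have h2 : C₁ * Real.exp (-(L / 2 : ℝ)) * Real.exp (K * t) ≤ C₁ * Real.exp (-(L / 4 : ℝ)) := by
        rw [mul_assoc, ← Real.exp_add]
        refine mul_le_mul_of_nonneg_left (Real.exp_le_exp.mpr ?_) hC₁
        have := mul_le_mul_of_nonneg_left h hK0
        linarith
      refine (mul_le_mul_of_nonneg_left (h1.trans h2) (Real.exp_pos _).le).trans ?_
      rw [mul_comm]
      exact le_add_of_nonneg_right (by positivity)
    · have h1 : ‖truncationDefect hV k ψ E L t‖ ≤ P :=
        norm_truncationDefect_le_poly hV k hC₂ hψ₂ E L t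
      refine (mul_le_mul_of_nonneg_left h1 (Real.exp_pos _).le).trans ?_
      refine le_add_of_nonneg_of_le (by positivity) ?_
      rw [mul_comm, mul_assoc P, ← Real.exp_add]
      refine mul_le_mul_of_nonneg_left (Real.exp_le_exp.mpr ?_) hP0
      nlinarith
  have hI1 := (exp_neg_integrableOn_Ioi 0 hε).const_mul (C₁ * Real.exp (-(L / 4 : ℝ)))
  have hI2 := (exp_neg_integrableOn_Ioi 0 (half_pos hε)).const_mul (P * Real.exp (-(ε * p / 2)))
  have hint := norm_integral_le_of_norm_le (hI1.add hI2)
    ((ae_restrict_mem measurableSet_Ioi).mono fun t ht => hbound t ht)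
  have hval : ∫ t in Set.Ioi (0 : ℝ), (C₁ * Real.exp (-(L / 4 : ℝ)) * Real.exp (-ε * t) +
      P * Real.exp (-(ε * p / 2)) * Real.exp (-(ε / 2) * t)) =
      (C₁ * Real.exp (-(L / 4 : ℝ)) + 2 * P * Real.exp (-(ε * p / 2))) / ε := by
    rw [integral_add hI1 hI2, integral_const_mul, integral_const_mul,
      integral_exp_mul_Ioi (by linarith), integral_exp_mul_Ioi (by linarith)]
    simp only [mul_zero, Real.exp_zero]
    field_simp
  rw [sub_sum_green_eq hV k ψ E L hε, norm_mul, Complex.norm_real, Real.norm_of_nonneg hε.le]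
  have h3 := mul_le_mul_of_nonneg_left (hint.trans_eq hval) hε.le
  rw [mul_div_cancel₀ _ hε.ne'] at h3
  refine h3.trans (le_of_eq ?_)
  congr 3
  rw [hp]
  congr 1
  field_simp
  ring

-- This is where α > 1 enters: with ε = 1/(2T) and L ≥ T^α, εL is at least T^{α-1}/2, and its
-- exponential beats every power of L.
open Filter Topology in
theorem tendsto_truncation_error {α c : ℝ} (hα : 1 < α) (hc : 0 < c) (C₁ C₂ : ℝ) (N : ℕ) :
    Tendsto (fun T : ℝ => C₁ * Real.exp (-(⌈T ^ α⌉₊ / 4 : ℝ)) +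
      C₂ * (2 * ⌈T ^ α⌉₊ + 1) ^ N * Real.exp (-(1 / (2 * T) * (⌈T ^ α⌉₊ / c)))) atTop (𝓝 0) := by
  have hα' : 0 < α - 1 := by linarith
  have hx : Tendsto (fun T : ℝ => T ^ (α - 1)) atTop atTop := tendsto_rpow_atTop hα'
  have hL : Tendsto (fun T : ℝ => (⌈T ^ α⌉₊ : ℝ)) atTop atTop :=
    tendsto_natCast_atTop_atTop.comp (tendsto_nat_ceil_atTop.comp (tendsto_rpow_atTop (by linarith)))
  have h1 : Tendsto (fun T : ℝ => C₁ * Real.exp (-(⌈T ^ α⌉₊ / 4 : ℝ))) atTop (𝓝 0) := by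
    have := (Real.tendsto_exp_neg_atTop_nhds_zero.comp
      (hL.atTop_div_const (by norm_num : (0 : ℝ) < 4))).const_mul C₁
    simpa using this
  -- In the variable x = T^{α-1}, T^{αN} is a power of x. The 5 comes from 2⌈T^α⌉ + 1 ≤ 5 T^α for T
  -- ≥ 1.
  have h2 : Tendsto (fun T : ℝ => |C₂| * 5 ^ N * ((T ^ (α - 1)) ^ (α * N / (α - 1)) *
      Real.exp (-(1 / (2 * c)) * T ^ (α - 1)))) atTop (𝓝 0) := by
    have := ((tendsto_rpow_mul_exp_neg_mul_atTop_nhds_zero (α * N / (α - 1)) (1 / (2 * c))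
      (by positivity)).comp hx).const_mul (|C₂| * 5 ^ N)
    simpa using this
  rw [← add_zero (0 : ℝ)]
  refine h1.add (squeeze_zero_norm' ?_ h2)
  filter_upwards [eventually_ge_atTop 1] with T hT
  have hT0 : 0 < T := by linarith
  have hTα : 1 ≤ T ^ α := Real.one_le_rpow hT (by linarith)
  have hle : (⌈T ^ α⌉₊ : ℝ) ≤ 2 * T ^ α := by
    linarith [(Nat.ceil_lt_add_one (by linarith : 0 ≤ T ^ α)).le]
  have hge : T ^ α ≤ ⌈T ^ α⌉₊ := Nat.le_ceil _
  rw [norm_mul, norm_mul, Real.norm_eq_abs C₂, Real.norm_of_nonneg (Real.exp_pos _).le,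
    Real.norm_of_nonneg (by positivity), mul_assoc, mul_assoc]
  refine mul_le_mul_of_nonneg_left ?_ (abs_nonneg _)
  rw [← mul_assoc]
  refine mul_le_mul ?_ (Real.exp_le_exp.mpr ?_) (Real.exp_pos _).le (by positivity)
  · rw [← Real.rpow_mul hT0.le, mul_div_cancel₀ _ hα'.ne', Real.rpow_mul hT0.le,
      Real.rpow_natCast, ← mul_pow]
    exact pow_le_pow_left₀ (by positivity) (by linarith) N
  · rw [Real.rpow_sub_one hT0.ne', neg_mul, neg_le_neg_iff]
    calc 1 / (2 * c) * (T ^ α / T) = 1 / (2 * T) * (T ^ α / c) := by field_simp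
      _ ≤ _ := by gcongr

/-- If the eigenfunction has slow growth relative to `φ`, then the Green's function is large in the
`φ`-weighted norm on the cube of radius `T^α`. -/
theorem exists_le_sum_green {φ : (Fin d → ℤ) → ℝ} (hφ_pos : ∀ n, 0 < φ n) {k : Fin d → ℤ}
    {ψ : (Fin d → ℤ) → ℂ} {E A ν α : ℝ} (hψ : IsPBGenEigenfunction V E ψ) (hψk : ψ k ≠ 0)
    (hν₀ : 0 ≤ ν) (hν₁ : ν < 1) (hα : 1 < α) (hA : 0 < A)
    (hAL : ∀ L : ℕ, 0 < L → ∑ n ∈ cube k L, ‖ψ n‖ ^ 2 / φ n ≤ A * (L : ℝ) ^ ν) :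
    ∃ T₀ c : ℝ, 0 < c ∧ ∀ T : ℝ, 1 ≤ T → T₀ ≤ T → c * T ^ (2 - α * ν) ≤
      ∑ n ∈ cube k ⌈T ^ α⌉₊, φ n * ‖green V hV k (1 / (2 * T)) E n‖ ^ 2 := by
  obtain ⟨B, hVB⟩ := id hV
  have hB : 0 ≤ B := (abs_nonneg _).trans (hVB 0)
  have hK0 : 0 ≤ growthRate d B := growthRate_nonneg hB
  obtain ⟨hE, m, C, hC, hψC⟩ := hψ
  have hψ₂ : ∀ n, ‖ψ n‖ ≤ C * (1 + ‖k‖) ^ m * (1 + ‖n - k‖) ^ m := fun n => by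
    refine (hψC n).trans ?_
    rw [mul_assoc, ← mul_pow]
    exact mul_le_mul_of_nonneg_left
      (pow_le_pow_left₀ (Real.sqrt_nonneg _) (bracket_le k n) m) hC.le
  obtain ⟨c₁, hc₁, hexp⟩ := one_add_pow_le_exp m
  have hψ₁ : ∀ n, ‖ψ n‖ ≤ C * (1 + ‖k‖) ^ m * c₁ * Real.exp (‖n - k‖ / 2) := fun n => by
    refine (hψ₂ n).trans ?_
    rw [mul_assoc _ c₁]
    exact mul_le_mul_of_nonneg_left (hexp _ (norm_nonneg _)) (by positivity)
  have hψpos : 0 < ‖ψ k‖ := norm_pos_iff.mpr hψk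
  have hlim := tendsto_truncation_error hα (c := 8 * (growthRate d B + 1)) (by positivity)
    (C * (1 + ‖k‖) ^ m * c₁) (2 * (2 * (C * (1 + ‖k‖) ^ m))) (d + m)
  obtain ⟨T₀, hT₀⟩ := Filter.eventually_atTop.mp
    (hlim.eventually (gt_mem_nhds (half_pos hψpos)))
  refine ⟨T₀, ‖ψ k‖ ^ 2 / (2 * A), by positivity, fun T hT1 hT => ?_⟩
  have hTpos : 0 < T := by linarith
  have hε : 0 < 1 / (2 * T) := by positivity
  set L := ⌈T ^ α⌉₊ with hL
  have hTα : 1 ≤ T ^ α := Real.one_le_rpow hT1 (by linarith)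
  have hLpos : 0 < L := Nat.ceil_pos.mpr (by linarith)
  have hLle : (L : ℝ) ≤ 2 * T ^ α := by
    linarith [(Nat.ceil_lt_add_one (by linarith : 0 ≤ T ^ α)).le]
  set S := ∑ n ∈ cube k L, φ n * ‖green V hV k (1 / (2 * T)) E n‖ ^ 2 with hS
  have hS0 : 0 ≤ S := Finset.sum_nonneg fun n _ => mul_nonneg (hφ_pos n).le (sq_nonneg _)
  have herr := (norm_sub_sum_green_le hV hB hVB k (by positivity) (by positivity) hψ₁ hψ₂ hE L
    hε).trans_lt (lt_of_le_of_lt (le_of_eq (by ring)) (hT₀ T hT))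
  -- The truncation error is below ‖ψ k‖ / 2, so the truncated sum times 1/(2T) has modulus at least
  -- ‖ψ k‖ / 2.
  have hmain : ‖ψ k‖ * T ≤ ∑ n ∈ cube k L, ‖ψ n‖ * ‖green V hV k (1 / (2 * T)) E n‖ := by
    have h1 := norm_sub_norm_le (ψ k)
      ((1 / (2 * T) : ℝ) * ∑ n ∈ cube k L, ψ n * green V hV k (1 / (2 * T)) E n)
    have h2 : ‖((1 / (2 * T) : ℝ) : ℂ) * ∑ n ∈ cube k L, ψ n * green V hV k (1 / (2 * T)) E n‖ ≤
        1 / (2 * T) * ∑ n ∈ cube k L, ‖ψ n‖ * ‖green V hV k (1 / (2 * T)) E n‖ := by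
      rw [norm_mul, Complex.norm_real, Real.norm_of_nonneg hε.le]
      refine mul_le_mul_of_nonneg_left ((norm_sum_le _ _).trans (le_of_eq ?_)) hε.le
      exact Finset.sum_congr rfl fun n _ => norm_mul _ _
    have h3 : ‖ψ k‖ / 2 ≤
        1 / (2 * T) * ∑ n ∈ cube k L, ‖ψ n‖ * ‖green V hV k (1 / (2 * T)) E n‖ := by linarith
    rw [one_div_mul_eq_div, le_div_iff₀ (by positivity)] at h3
    linarith
  -- Cauchy–Schwarz after writing |ψ| |G| = (|ψ| / √φ) (√φ |G|).
  have hcs : (∑ n ∈ cube k L, ‖ψ n‖ * ‖green V hV k (1 / (2 * T)) E n‖) ^ 2 ≤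
      (∑ n ∈ cube k L, ‖ψ n‖ ^ 2 / φ n) * S := by
    refine Finset.sum_sq_le_sum_mul_sum_of_sq_le_mul _
      (fun n _ => div_nonneg (sq_nonneg _) (hφ_pos n).le)
      (fun n _ => mul_nonneg (hφ_pos n).le (sq_nonneg _)) fun n _ => le_of_eq ?_
    have := (hφ_pos n).ne'
    field_simp
  have hLν : (L : ℝ) ^ ν ≤ 2 * T ^ (α * ν) := by
    refine (Real.rpow_le_rpow (Nat.cast_nonneg L) hLle hν₀).trans ?_
    rw [Real.mul_rpow (by norm_num) (by linarith), ← Real.rpow_mul hTpos.le]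
    refine mul_le_mul_of_nonneg_right ?_ (Real.rpow_nonneg hTpos.le _)
    simpa using Real.rpow_le_rpow_of_exponent_le (one_le_two) hν₁.le
  have hfin : (‖ψ k‖ * T) ^ 2 ≤ A * (2 * T ^ (α * ν)) * S :=
    ((pow_le_pow_left₀ (by positivity) hmain 2).trans hcs).trans
      (mul_le_mul_of_nonneg_right ((hAL L hLpos).trans (mul_le_mul_of_nonneg_left hLν hA.le)) hS0)
  have hTν : 0 < T ^ (α * ν) := Real.rpow_pos_of_pos hTpos _
  rw [Real.rpow_sub hTpos, Real.rpow_two, div_mul_div_comm, div_le_iff₀ (by positivity)]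
  linarith

end

/-! ### Lower bounds for the moment on bounded and on long time scales. -/

section

variable {d : ℕ} {V : (Fin d → ℤ) → ℝ} {hV : ∃ B : ℝ, ∀ n, |V n| ≤ B} {φ : (Fin d → ℤ) → ℝ}

/-- On bounded time scales the moment is bounded below by a positive constant. -/
theorem exists_le_moment_of_le (hφ_pos : ∀ n, 0 < φ n) (hφ : HasSubexpGrowth φ)
    (k : Fin d → ℤ) {T₀ : ℝ} (hT₀ : 0 < T₀) :
    ∃ c : ℝ, 0 < c ∧ ∀ T : ℝ, 0 < T → T ≤ T₀ → c ≤ moment V hV φ k T := by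
  have h0 : ‖wave V hV k 0 k‖ = 1 := by
    simp [wave, evolution, delta_apply]
  have hcont : Continuous fun t => ‖wave V hV k t k‖ := (continuous_wave_apply V hV k k).norm
  have hhalf : (1 / 2 : ℝ) < ‖wave V hV k 0 k‖ := by rw [h0]; norm_num
  have hnear := (hcont.tendsto 0).eventually (lt_mem_nhds hhalf)
  obtain ⟨r, hr, hball⟩ := Metric.eventually_nhds_iff.mp hnear
  -- On (0, Ts] both t ≤ T, so the damping is at least e^{-1}, and t < r, so the site k alone
  -- contributes φ(k)/4. The length Ts cancels the prefactor 1/T.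
  set s := min 1 (r / (2 * T₀)) with hs
  have hs0 : 0 < s := lt_min one_pos (by positivity)
  have hk := hφ_pos k
  refine ⟨s * (Real.exp (-1) * (φ k / 4)), by positivity, fun T hT hTT₀ => ?_⟩
  have hint := integrableOn_expectation (V := V) (hV := hV) hφ_pos hφ k hT
  have hτ : 0 < T * s := by positivity
  have hpt : ∀ t ∈ Set.Ioc 0 (T * s), Real.exp (-1) * (φ k / 4) ≤
      Real.exp (-(t / T)) * expectation V hV φ k t := fun t ht => by
    have h1 : t / T ≤ 1 := by
      rw [div_le_one hT]
      exact ht.2.trans (mul_le_of_le_one_right hT.le (min_le_left _ _))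
    have h2 : t < r := by
      have h3 : T * s ≤ T₀ * (r / (2 * T₀)) :=
        mul_le_mul hTT₀ (min_le_right _ _) hs0.le hT₀.le
      have h4 : T₀ * (r / (2 * T₀)) = r / 2 := by field_simp
      linarith [ht.2]
    have h3 : 1 / 2 < ‖wave V hV k t k‖ := hball (by
      rw [Real.dist_eq, sub_zero, abs_of_pos ht.1]; exact h2)
    have h4 : φ k / 4 ≤ expectation V hV φ k t := by
      have h5 := le_hasSum (hasSum_expectation (inDomain_wave (V := V) (hV := hV) hφ_pos hφ k t)) k
        fun n _ => mul_nonneg (hφ_pos n).le (sq_nonneg _)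
      have h6 : 1 / 4 ≤ ‖wave V hV k t k‖ ^ 2 := by nlinarith
      linarith [mul_le_mul_of_nonneg_left h6 hk.le]
    exact mul_le_mul (Real.exp_le_exp.mpr (by linarith)) h4 (by positivity) (Real.exp_pos _).le
  have hsub : Set.Ioc 0 (T * s) ⊆ Set.Ioi (0 : ℝ) := fun t ht => ht.1
  have h1 : T * s * (Real.exp (-1) * (φ k / 4)) ≤ ∫ t in Set.Ioc 0 (T * s),
      Real.exp (-(t / T)) * expectation V hV φ k t := by
    have h2 := setIntegral_mono_on (integrableOn_const (by simp)) (hint.mono_set hsub)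
      measurableSet_Ioc hpt
    rw [setIntegral_const, smul_eq_mul, Real.volume_real_Ioc_of_le hτ.le, sub_zero] at h2
    exact h2
  have h2 := setIntegral_mono_set hint (Filter.Eventually.of_forall fun t =>
    mul_nonneg (Real.exp_pos _).le (expectation_nonneg hφ_pos hφ k t)) hsub.eventuallyLE
  rw [moment, one_div_mul_eq_div, le_div_iff₀ hT]
  linarith

/-- The threshold and constant of `exists_le_sum_green` depend on E. The sets `J N` of energies for
which N and 1/(N+1) serve cover I up to a null set, so one of them has positive outer measure. No
measurability of I or of the choice of ψ in E is needed. -/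
theorem exists_le_moment_of_large (hφ_pos : ∀ n, 0 < φ n) (hφ : HasSubexpGrowth φ)
    {I : Set ℝ} (hI : 0 < volume I) {ν α : ℝ} (hν₀ : 0 ≤ ν) (hν₁ : ν < 1) (hα : 1 < α)
    (k : Fin d → ℤ)
    (hψ : ∀ᵐ E : ℝ, E ∈ I → ∃ ψ : (Fin d → ℤ) → ℂ, IsPBGenEigenfunction V (E : ℂ) ψ ∧ ψ k ≠ 0 ∧
      ∃ A : ℝ, 0 < A ∧ ∀ L : ℕ, 0 < L →
        ∑ n ∈ cube k L, ‖ψ n‖ ^ 2 / φ n ≤ A * (L : ℝ) ^ ν) :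
    ∃ T₀ c : ℝ, 1 ≤ T₀ ∧ 0 < c ∧ ∀ T : ℝ, T₀ ≤ T →
      c * T ^ (1 - α * ν) ≤ moment V hV φ k T := by
  have hpi := Real.pi_pos
  set J : ℕ → Set ℝ := fun N => {E | ∀ T : ℝ, 1 ≤ T → N ≤ T → 1 / ((N : ℝ) + 1) * T ^ (2 - α * ν) ≤
    ∑ n ∈ cube k ⌈T ^ α⌉₊, φ n * ‖green V hV k (1 / (2 * T)) E n‖ ^ 2} with hJ
  have hmem : ∀ᵐ E : ℝ, E ∈ I → E ∈ ⋃ N, J N := by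
    filter_upwards [hψ] with E hE hEI
    obtain ⟨ψ, hgen, hk, A, hA, hAL⟩ := hE hEI
    obtain ⟨T₀, c, hc, h⟩ := exists_le_sum_green hV hφ_pos hgen hk hν₀ hν₁ hα hA hAL
    obtain ⟨N, hN⟩ := exists_nat_ge (max T₀ (1 / c))
    refine Set.mem_iUnion.mpr ⟨N, fun T hT1 hTN => ?_⟩
    refine le_trans (mul_le_mul_of_nonneg_right ?_ (Real.rpow_nonneg (by linarith) _))
      (h T hT1 ((le_max_left _ _).trans (hN.trans hTN)))
    have h1 : 1 / c ≤ (N : ℝ) + 1 := ((le_max_right _ _).trans hN).trans (by linarith)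
    rw [div_le_iff₀ hc] at h1
    rw [div_le_iff₀ (by positivity)]
    linarith
  obtain ⟨N, hN⟩ : ∃ N, volume (J N) ≠ 0 := by
    by_contra! h
    have h1 : volume I ≤ volume (⋃ N, J N) := measure_mono_ae hmem
    rw [measure_iUnion_null h] at h1
    exact hI.not_ge h1
  -- Capped at 1 because `J N` may have infinite measure.
  set v := (min (volume (J N)) 1).toReal with hv
  have hv_top : min (volume (J N)) 1 ≠ ⊤ := ne_top_of_le_ne_top ENNReal.one_ne_top (min_le_right _ _)
  have hv0 : 0 < v := ENNReal.toReal_pos (by simp [hN]) hv_top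
  refine ⟨max 1 N, 1 / (2 * Real.pi) * (1 / ((N : ℝ) + 1)) * v, le_max_left _ _, by positivity,
    fun T hT => ?_⟩
  have hT1 : 1 ≤ T := (le_max_left _ _).trans hT
  have hTN : (N : ℝ) ≤ T := (le_max_right _ _).trans hT
  have hT0 : 0 < T := by linarith
  have hε : 0 < 1 / (2 * T) := by positivity
  set f : ℝ → ENNReal := fun E => ∑ n ∈ cube k ⌈T ^ α⌉₊,
    ENNReal.ofReal (φ n) * ‖green V hV k (1 / (2 * T)) E n‖ₑ ^ 2 with hf
  have hfm : Measurable f := Finset.measurable_fun_sum _ fun n _ =>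
    (((continuous_green V hV k n hε).measurable.enorm).pow_const 2).const_mul _
  set a : ℝ := 1 / ((N : ℝ) + 1) * T ^ (2 - α * ν) with ha
  have ha0 : 0 ≤ a := mul_nonneg (by positivity) (Real.rpow_nonneg hT0.le _)
  -- Markov's inequality is applied to this superlevel set of the measurable f, whose measure is at
  -- least the outer measure of `J N`.
  have hsub : J N ⊆ {E | ENNReal.ofReal a ≤ f E} := fun E hE => by
    refine (ENNReal.ofReal_le_ofReal (hE T hT1 hTN)).trans (le_of_eq ?_)
    rw [ENNReal.ofReal_sum_of_nonneg fun n _ => mul_nonneg (hφ_pos n).le (sq_nonneg _)]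
    refine Finset.sum_congr rfl fun n _ => ?_
    rw [ENNReal.ofReal_mul (hφ_pos n).le, ENNReal.ofReal_pow (norm_nonneg _), ofReal_norm]
  have hmom : 0 ≤ moment V hV φ k T := mul_nonneg (by positivity)
    (integral_nonneg fun t => mul_nonneg (Real.exp_pos _).le (expectation_nonneg hφ_pos hφ k t))
  have h1 : ENNReal.ofReal (1 / (2 * Real.pi * T) * (a * v)) ≤
      ENNReal.ofReal (moment V hV φ k T) := by
    refine le_trans ?_ (le_moment (V := V) (hV := hV) hφ_pos hφ k hT0 (cube k ⌈T ^ α⌉₊))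
    rw [ENNReal.ofReal_mul (by positivity), ENNReal.ofReal_mul ha0, hv, ENNReal.ofReal_toReal hv_top]
    refine mul_le_mul_right (le_trans ?_ (mul_meas_ge_le_lintegral hfm (ENNReal.ofReal a))) _
    exact mul_le_mul_right ((min_le_left _ _).trans (measure_mono hsub)) _
  refine le_trans (le_of_eq ?_) ((ENNReal.ofReal_le_ofReal_iff hmom).mp h1)
  rw [ha, show 2 - α * ν = 1 - α * ν + 1 by ring, Real.rpow_add_one hT0.ne']
  field_simp

end

end LatticeTransport

end

theorem theorem2p3 (d : ℕ) (V : (Fin d → ℤ) → ℝ) (hV : ∃ B : ℝ, ∀ n, |V n| ≤ B)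
    (φ : (Fin d → ℤ) → ℝ) (hφ_pos : ∀ n, 0 < φ n) (hφ : LatticeTransport.HasSubexpGrowth φ)
    (I : Set ℝ) (hI : 0 < volume I) (ν : ℝ) (hν₀ : 0 ≤ ν) (hν₁ : ν < 1) (n₀ : Fin d → ℤ)
    (hψ : ∀ᵐ E : ℝ, E ∈ I → ∃ ψ : (Fin d → ℤ) → ℂ,
      LatticeTransport.IsPBGenEigenfunction V (E : ℂ) ψ ∧ ψ n₀ ≠ 0 ∧
      ∃ A : ℝ, 0 < A ∧ ∀ L : ℕ, 0 < L →
        ∑ n ∈ LatticeTransport.cube n₀ L, ‖ψ n‖ ^ 2 / φ n ≤ A * (L : ℝ) ^ ν) :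
    (∀ t : ℝ, LatticeTransport.InDomain φ
      (LatticeTransport.evolution V hV t (LatticeTransport.delta n₀))) ∧
    (∀ T : ℝ, 0 < T → IntegrableOn
      (fun t => Real.exp (-(t / T)) * LatticeTransport.expectation V hV φ n₀ t)
      (Set.Ioi (0 : ℝ))) ∧
    ∀ α : ℝ, 1 < α → ∃ C : ℝ, 0 < C ∧ ∀ T : ℝ, 0 < T → (1 ≤ T ∨ α * ν ≤ 1) →
      C * T ^ (1 - α * ν) ≤ LatticeTransport.moment V hV φ n₀ T := by
  refine ⟨fun t => LatticeTransport.inDomain_wave hφ_pos hφ n₀ t,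
    fun T hT => LatticeTransport.integrableOn_expectation hφ_pos hφ n₀ hT, fun α hα => ?_⟩
  obtain ⟨T₀, c, hT₀, hc, hlarge⟩ := LatticeTransport.exists_le_moment_of_large (hV := hV)
    hφ_pos hφ hI hν₀ hν₁ hα n₀ hψ
  have hT₀' : 0 < T₀ := by linarith
  obtain ⟨b, hb, hsmall⟩ := LatticeTransport.exists_le_moment_of_le (V := V) (hV := hV)
    hφ_pos hφ n₀ hT₀'
  have hM : 0 < max 1 (T₀ ^ (1 - α * ν)) := lt_max_of_lt_left one_pos
  refine ⟨min c (b / max 1 (T₀ ^ (1 - α * ν))), lt_min hc (div_pos hb hM), fun T hT hcase => ?_⟩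
  have hTν : 0 ≤ T ^ (1 - α * ν) := Real.rpow_nonneg hT.le _
  rcases le_total T₀ T with h | h
  · exact (mul_le_mul_of_nonneg_right (min_le_left _ _) hTν).trans (hlarge T h)
  -- For αν > 1 the power blows up as T → 0, which is why T ≥ 1 is required in that case.
  · have h1 : T ^ (1 - α * ν) ≤ max 1 (T₀ ^ (1 - α * ν)) := by
      rcases le_total (α * ν) 1 with h2 | h2
      · exact (Real.rpow_le_rpow hT.le h (by linarith)).trans (le_max_right _ _)
      · rcases hcase with h3 | h3
        · exact (Real.rpow_le_one_of_one_le_of_nonpos h3 (by linarith)).trans (le_max_left _ _)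
        · rw [le_antisymm h3 h2, sub_self, Real.rpow_zero]
          exact le_max_left _ _
    calc min c (b / max 1 (T₀ ^ (1 - α * ν))) * T ^ (1 - α * ν)
        ≤ b / max 1 (T₀ ^ (1 - α * ν)) * max 1 (T₀ ^ (1 - α * ν)) :=
          mul_le_mul (min_le_right _ _) h1 hTν (div_pos hb hM).le
      _ = b := div_mul_cancel₀ _ hM.ne'
      _ ≤ _ := hsmall T hT h
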